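/- **Setting.** Let $d,K\ge 1$. In each round $t=1,2,\dots$ the learner is given context vectors $x_{t,1},\dots,x_{t,K}\in\mathbb{R}^d$, drawn from a distribution that may depend on $t$ and on the interaction history $H_t=\big((x_{\tau,a})_a,\pi_\tau,a_\tau,r_\tau\big)_{\tau<t}$ but, given $H_t$, not on the true parameter $\mu^\star\in\mathbb{R}^d$ (fixed context sequences are a special case). The learner deploys a probability vector $\pi_t$ on the $K$ arms, an arm $a_t\sim\pi_t$ is drawn, and the reward $r_t=\mu^\star\cdot x_{t,a_t}+\eta_t$ is observed. For a measurable merit function $f:\mathbb{R}\to(0,\infty)$, the fair policy for a parameter $\mu$ in round $t$ is $$\pi_{t}^{\mu}(a)=\frac{f(\mu\cdot x_{t,a})}{\sum_{a'=1}^{K}f(\mu\cdot x_{t,a'})},$$ and the optimal fair policy is $\pi_t^\star=\pi_t^{\mu^\star}$. The algorithm FairX-LinTS samples, in each round $t$, a parameter $\mu_t$ from the posterior distribution of $\mu^\star$ given $H_t$ (for $t=1$ this is the prior), independently of $\mu^\star$ and of the contexts of round $t$ given $H_t$, and deploys $\pi_t=\pi_t^{\mu_t}$. Its Bayesian fairness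 regret after $T$ rounds is $$\mathrm{BayesFR}_T=\mathbb{E}_{\mu^\star}\Big[\mathbb{E}\Big[\sum_{t=1}^{T}\sum_{a=1}^{K}\big|\pi_t^\star(a)-\pi_t(a)\big|\,\Big|\,\mu^\star\Big]\Big].$$ **Theorem.** Suppose that for some constants $\gamma,L>0$ the merit function satisfies $f(m)\ge\gamma$ for all $m\in\mathbb{R}$ and $|f(m_1)-f(m_2)|\le L|m_1-m_2|$ for all $m_1,m_2\in\mathbb{R}$. Suppose that the coordinates of $\mu^\star$ are independent $\mathcal{N}(0,1)$ variables (and that this law is the prior used by the algorithm), that $\|x_{t,a}\|_2\le 1$ for all $t,a$, and that each noise variable $\eta_t$ is $\mathcal{N}(0,1)$-distributed and independent of $\mu^\star$, $H_t$, the contexts of round $t$, $\mu_t$ and $a_t$. Then $\mathrm{BayesFR}_T=\widetilde O\big(L\sqrt{dT}/\gamma\big)$, where $\widetilde O$ hides a universal constant and a fixed power of logarithmic factors in $K$ and $T$. That is, there are universal constants $C>0$ and $p\in\mathbb{N}$ such that, for all $d,K,T\ge1$ and all $f,L,\gamma$ and context distributions as above, $$\mathrm{BayesFR}_T\le C\,\frac{L\sqrt{dT}}{\gamma}\,\big(1+\log(KT)\big)^{p}.$$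 -/

import Mathlib

open MeasureTheory ProbabilityTheory
open scoped ENNReal

noncomputable section

namespace FairX

/-- The parameter space `ℝᵈ`, with its Euclidean norm and inner product. -/
abbrev Param (d : ℕ) : Type := EuclideanSpace ℝ (Fin d)

/-- The context vectors of the `K` arms in one round. -/
abbrev Contexts (d K : ℕ) : Type := Fin K → Param d

/-- What is recorded in one round: the contexts, the deployed policy, the chosen arm and the
observed reward. -/
abbrev Round (d K : ℕ) : Type := Contexts d K × (Fin K → ℝ) × Fin K × ℝ

/-- The interaction history of the first `n` rounds. -/
abbrev Hist (d K n : ℕ) : Type := Fin n → Round d K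

/-- A merit function: it maps the mean reward of an arm to a positive merit. -/
structure MeritFunction where
  /-- The underlying function. -/
  merit : ℝ → ℝ
  measurable_merit : Measurable merit
  merit_pos : ∀ x, 0 < merit x

variable {d K : ℕ}

/-- The fair policy for the contexts `x` and the parameter `θ`: arm `a` is chosen with probability
`f (θ · x a) / ∑ b, f (θ · x b)`. -/
def fairPolicy (f : MeritFunction) (x : Contexts d K) (θ : Param d) (a : Fin K) : ℝ :=
  f.merit (inner ℝ θ (x a)) / ∑ b, f.merit (inner ℝ θ (x b))

theorem measurable_fairPolicy (f : MeritFunction) (a : Fin K) :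
    Measurable fun p : Contexts d K × Param d => fairPolicy f p.1 p.2 a := by
  have h : ∀ b : Fin K, Measurable fun p : Contexts d K × Param d =>
      f.merit (inner ℝ p.2 (p.1 b)) := fun b =>
    f.measurable_merit.comp
      (measurable_snd.inner ((measurable_pi_apply b).comp measurable_fst))
  exact (h a).div (Finset.measurable_sum _ fun b _ => h b)

theorem fairPolicy_nonneg (f : MeritFunction) (x : Contexts d K) (θ : Param d) (a : Fin K) :
    0 ≤ fairPolicy f x θ a :=
  div_nonneg (f.merit_pos _).le (Finset.sum_nonneg fun _ _ => (f.merit_pos _).le)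

theorem sum_fairPolicy [NeZero K] (f : MeritFunction) (x : Contexts d K) (θ : Param d) :
    ∑ a, fairPolicy f x θ a = 1 := by
  unfold fairPolicy
  rw [← Finset.sum_div]
  exact div_self (Finset.sum_pos (fun _ _ => f.merit_pos _) Finset.univ_nonempty).ne'

/-- Sampling an arm from the fair policy, given the contexts and the parameter. -/
def armKernel (f : MeritFunction) : Kernel (Contexts d K × Param d) (Fin K) where
  toFun p := ∑ a, ENNReal.ofReal (fairPolicy f p.1 p.2 a) • Measure.dirac a
  measurable' := by
    refine Measure.measurable_of_measurable_coe _ fun s _ => ?_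
    simp only [Measure.coe_finsetSum, Finset.sum_apply, Measure.smul_apply, smul_eq_mul]
    exact Finset.measurable_sum _ fun a _ =>
      ((measurable_fairPolicy f a).ennreal_ofReal).mul_const _

instance [NeZero K] (f : MeritFunction) : IsMarkovKernel (armKernel (d := d) (K := K) f) := by
  refine ⟨fun p => ⟨?_⟩⟩
  change (∑ a, ENNReal.ofReal (fairPolicy f p.1 p.2 a) • Measure.dirac a : Measure (Fin K))
    Set.univ = 1
  simp only [Measure.coe_finsetSum, Finset.sum_apply, Measure.smul_apply, smul_eq_mul,
    measure_univ, mul_one]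
  rw [← ENNReal.ofReal_sum_of_nonneg fun a _ => fairPolicy_nonneg f _ _ a, sum_fairPolicy,
    ENNReal.ofReal_one]

/-- The reward of an arm with mean reward `m`: it is `m + η` with noise `η ∼ N(0, 1)`. -/
def rewardKernel : Kernel ℝ ℝ where
  toFun m := gaussianReal m 1
  measurable' := by
    exact measurable_gaussianReal.comp (measurable_id.prodMk measurable_const)

instance : IsMarkovKernel rewardKernel :=
  ⟨fun m => inferInstanceAs (IsProbabilityMeasure (gaussianReal m 1))⟩

theorem measurable_meanReward {α : Type*} [MeasurableSpace α] {μ : α → Param d}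
    {x : α → Contexts d K} {a : α → Fin K} (hμ : Measurable μ) (hx : Measurable x)
    (ha : Measurable a) : Measurable fun p => (inner ℝ (μ p) (x p (a p)) : ℝ) := by
  have h : Measurable fun q : Contexts d K × Fin K => q.1 q.2 :=
    measurable_from_prod_countable_left fun a => measurable_pi_apply a
  exact hμ.inner (h.comp (hx.prodMk ha))

/-- One round of posterior sampling, given the true parameter `μ` and the history `h`, where `ctx`
generates the contexts from the history and `post` is the posterior of the parameter given the
history: draw the contexts `x` from `ctx h` and a parameter `θ` from `post h`, deploy the fair
policy for `x` and `θ`, draw an arm `a` from it, and observe a reward with law `N(μ · x a, 1)`.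
The draws are conditionally independent of everything that is not named here. -/
def roundKernel {n : ℕ} (f : MeritFunction) (ctx : Kernel (Hist d K n) (Contexts d K))
    (post : Kernel (Hist d K n) (Param d)) : Kernel (Param d × Hist d K n) (Round d K) :=
  (((ctx ×ₖ post).comap (fun p : Param d × Hist d K n => p.2) measurable_snd
      ⊗ₖ (armKernel f).comap
        (fun p : (Param d × Hist d K n) × (Contexts d K × Param d) => p.2) measurable_snd)
      ⊗ₖ rewardKernel.comap
        (fun p : (Param d × Hist d K n) × ((Contexts d K × Param d) × Fin K) =>
          (inner ℝ p.1.1 (p.2.1.1 p.2.2) : ℝ))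
        (measurable_meanReward measurable_fst.fst measurable_snd.fst.fst measurable_snd.snd)).map
    fun q : ((Contexts d K × Param d) × Fin K) × ℝ =>
      (q.1.1.1, fairPolicy f q.1.1.1 q.1.1.2, q.1.2, q.2)

instance [NeZero K] {n : ℕ} (f : MeritFunction) (ctx : Kernel (Hist d K n) (Contexts d K))
    [IsMarkovKernel ctx] (post : Kernel (Hist d K n) (Param d)) [IsMarkovKernel post] :
    IsMarkovKernel (roundKernel f ctx post) := by
  unfold roundKernel
  have h : Measurable fun q : ((Contexts d K × Param d) × Fin K) × ℝ =>
      (q.1.1.1, fairPolicy f q.1.1.1 q.1.1.2, q.1.2, q.2) :=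
    measurable_fst.fst.fst.prodMk
      ((measurable_pi_lambda _ fun a => (measurable_fairPolicy f a).comp measurable_fst.fst).prodMk
        (measurable_fst.snd.prodMk measurable_snd))
  exact Kernel.IsMarkovKernel.map _ h

/-- Appending a round to a history. -/
def append (n : ℕ) : Hist d K n × Round d K → Hist d K (n + 1) :=
  fun p => Fin.snoc (α := fun _ => Round d K) p.1 p.2

theorem measurable_append (n : ℕ) : Measurable (append (d := d) (K := K) n) := by
  refine measurable_pi_lambda _ fun i => ?_
  induction i using Fin.lastCases with
  | last => simpa [append] using measurable_snd
  | cast i => simpa [append] using! (measurable_pi_apply i).comp measurable_fst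

/-- The law of the history of the first `n` rounds of the algorithm with merit function `f` and
prior `prior`, as a kernel in the true parameter. In round `n + 1` the algorithm samples from the
posterior of the true parameter given the first `n` rounds. -/
def histKernelAux [NeZero K] (f : MeritFunction) (prior : Measure (Param d))
    [IsProbabilityMeasure prior] (ctx : ∀ n, Kernel (Hist d K n) (Contexts d K))
    [∀ n, IsMarkovKernel (ctx n)] :
    (n : ℕ) → {κ : Kernel (Param d) (Hist d K n) // IsMarkovKernel κ}
  | 0 => ⟨Kernel.const _ (Measure.dirac Fin.elim0), inferInstance⟩
  | n + 1 =>
    let κ := (histKernelAux f prior ctx n).1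
    haveI : IsMarkovKernel κ := (histKernelAux f prior ctx n).2
    ⟨(κ ⊗ₖ roundKernel f (ctx n) (posterior κ prior)).map (append n),
      Kernel.IsMarkovKernel.map _ (measurable_append n)⟩

/-- The law of the history of the first `n` rounds given the true parameter. -/
def histKernel [NeZero K] (f : MeritFunction) (prior : Measure (Param d))
    [IsProbabilityMeasure prior] (ctx : ∀ n, Kernel (Hist d K n) (Contexts d K))
    [∀ n, IsMarkovKernel (ctx n)] (n : ℕ) : Kernel (Param d) (Hist d K n) :=
  (histKernelAux f prior ctx n).1

instance [NeZero K] (f : MeritFunction) (prior : Measure (Param d))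
    [IsProbabilityMeasure prior] (ctx : ∀ n, Kernel (Hist d K n) (Contexts d K))
    [∀ n, IsMarkovKernel (ctx n)] (n : ℕ) : IsMarkovKernel (histKernel f prior ctx n) :=
  (histKernelAux f prior ctx n).2

theorem histKernel_zero [NeZero K] (f : MeritFunction) (prior : Measure (Param d))
    [IsProbabilityMeasure prior] (ctx : ∀ n, Kernel (Hist d K n) (Contexts d K))
    [∀ n, IsMarkovKernel (ctx n)] :
    histKernel f prior ctx 0 = Kernel.const _ (Measure.dirac Fin.elim0) := rfl

theorem histKernel_succ [NeZero K] (f : MeritFunction) (prior : Measure (Param d))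
    [IsProbabilityMeasure prior] (ctx : ∀ n, Kernel (Hist d K n) (Contexts d K))
    [∀ n, IsMarkovKernel (ctx n)] (n : ℕ) :
    histKernel f prior ctx (n + 1) =
      (histKernel f prior ctx n ⊗ₖ
        roundKernel f (ctx n) (posterior (histKernel f prior ctx n) prior)).map (append n) := rfl

/-- The fairness regret of a history: the cumulative `ℓ¹` distance between the optimal fair policy,
i.e. the fair policy for the true parameter `μ`, and the deployed policy. -/
def fairnessRegret {T : ℕ} (f : MeritFunction) (μ : Param d) (h : Hist d K T) : ℝ :=
  ∑ t, ∑ a, |fairPolicy f (h t).1 μ a - (h t).2.1 a|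

/-- The Bayesian fairness regret after `T` rounds: the expectation over the prior of the expected
fairness regret given the true parameter. -/
def bayesFairnessRegret [NeZero K] (f : MeritFunction) (prior : Measure (Param d))
    [IsProbabilityMeasure prior] (ctx : ∀ n, Kernel (Hist d K n) (Contexts d K))
    [∀ n, IsMarkovKernel (ctx n)] (T : ℕ) : ℝ :=
  ∫ μ, ∫ h, fairnessRegret f μ h ∂(histKernel f prior ctx T μ) ∂prior

end FairX

end

/-! Given the history, the true parameter and the sampled one are independent draws from the same
Gaussian posterior; write them as `m + B z` and `m + B z'` with `z`, `z'` standard Gaussian. Since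
`f ≥ γ` and `f` is `L`-Lipschitz, the `ℓ¹` distance of the two fair policies is at most `2L/γ` times
the average of `|⟪μ - θ, x a⟫|` over an arm drawn from the deployed policy
(`sum_abs_fairPolicy_sub_le`). Errors are thus charged exactly to the arms that are explored, so no
optimism and no lower bound on arm probabilities is needed.

With `u a = Bᵀ (x a)` the error is `⟪z - z', u a⟫`, and `‖u a‖²` is the posterior variance in
direction `x a`. A weighted AM-GM inequality with weight `l` splits it into `l · log (1 + ‖u a‖²)`
and `1/l` times the square of a Gaussian. The arm depends on `z'`, so the square is bounded
uniformly over the arms by an exponential moment, at the price of `log K`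
(`abs_inner_le_of_norm_le_one`). The average of `log (1 + ‖u a‖²)` over the played arm is exactly
the expected growth of the log-determinant of the precision matrix. It telescopes, and the total is
at most `d log (1 + T)` by `logDet_le`. Taking `l = √(T/d)` balances the two contributions.

The algorithm samples from the abstract `posterior`, so this kernel must be identified as Gaussian.
That is an induction over rounds (`isGaussPosterior`) whose step is the conjugacy
`lintegral_conjugacy`, obtained from a rotation of `ℝᵈ × ℝ` that preserves the standard Gaussian.
All integrals are taken in `[0, ∞]`, so that Tonelli applies without integrability conditions. -/

noncomputable section

namespace FairX

variable {d K : ℕ}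

/-! ### Square roots of rank-one updates -/

section RankOne

variable {E : Type*} [NormedAddCommGroup E]

/-- The standard deviation `√(1 + ‖u‖²)` of `⟪z, u⟫ + w` for independent standard Gaussian
`z` and `w`. -/
def scale (u : E) : ℝ := √(1 + ‖u‖ ^ 2)

theorem scale_pos (u : E) : 0 < scale u := Real.sqrt_pos.2 (by positivity)

theorem scale_sq (u : E) : scale u ^ 2 = 1 + ‖u‖ ^ 2 := Real.sq_sqrt (by positivity)

/-- The coefficient `c` for which `1 - c u uᵀ` is the positive square root of `(1 + u uᵀ)⁻¹`. -/
def shrinkCoef (u : E) : ℝ := (scale u * (scale u + 1))⁻¹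

/-- This is the eigenvalue of `shrink u` on the line through `u`; the orthogonal complement of `u`
is fixed. The other identities for `shrink` follow from it. -/
theorem one_sub_shrinkCoef_mul (u : E) : 1 - shrinkCoef u * ‖u‖ ^ 2 = (scale u)⁻¹ := by
  have h := scale_pos u
  have hs : ‖u‖ ^ 2 = scale u ^ 2 - 1 := by rw [scale_sq]; ring
  rw [hs, shrinkCoef]
  field_simp
  ring

variable [InnerProductSpace ℝ E]

/-- The operator `(1 + u uᵀ)^(-1/2)`. -/
def shrink (u z : E) : E := z - (shrinkCoef u * inner ℝ u z) • u

theorem inner_shrink_left (u y z : E) : inner ℝ (shrink u y) z = (inner ℝ y (shrink u z) : ℝ) := by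
  simp only [shrink, inner_sub_left, inner_sub_right, real_inner_smul_left, real_inner_smul_right]
  rw [real_inner_comm u y]
  ring

theorem inner_shrink_self (u z : E) : inner ℝ u (shrink u z) = (inner ℝ u z / scale u : ℝ) := by
  simp only [shrink, inner_sub_right, real_inner_smul_right, real_inner_self_eq_norm_sq]
  rw [div_eq_mul_inv, ← one_sub_shrinkCoef_mul]
  ring

theorem norm_shrink_sq (u z : E) :
    ‖shrink u z‖ ^ 2 = ‖z‖ ^ 2 - (inner ℝ u z / scale u) ^ 2 := by
  have h := scale_pos u
  have h1 := one_sub_shrinkCoef_mul u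
  have h2 : shrinkCoef u * (1 + (scale u)⁻¹) = (scale u)⁻¹ ^ 2 := by
    rw [shrinkCoef]; field_simp
  rw [← real_inner_self_eq_norm_sq, inner_shrink_left]
  conv_lhs => rw [shrink, inner_sub_right, real_inner_smul_right, shrink]
  simp only [inner_sub_right, real_inner_smul_right, real_inner_self_eq_norm_sq]
  rw [real_inner_comm u z, div_eq_mul_inv, mul_pow, ← h2, ← h1]
  ring

theorem norm_shrink_le (u z : E) : ‖shrink u z‖ ≤ ‖z‖ := by
  have h := norm_shrink_sq u z
  exact le_of_sq_le_sq (by nlinarith [sq_nonneg (inner ℝ u z / scale u)]) (norm_nonneg _)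

end RankOne

/-! ### Conjugacy of the Gaussian prior and the Gaussian linear model -/

/-- The rotation of `ℝᵈ × ℝ` that relates the two orders in which a Gaussian parameter and a noisy
linear observation can be sampled. -/
def rotation (u : Param d) (p : Param d × ℝ) : Param d × ℝ :=
  (shrink u p.1 + (p.2 / scale u) • u, (p.2 - inner ℝ u p.1) / scale u)

theorem measurable_rotation (u : Param d) : Measurable (rotation u) := by
  unfold rotation shrink; fun_prop

/-- The rotation is orthogonal and the characteristic function of a standard Gaussian depends only
on the norm of its argument. -/
theorem measurePreserving_rotation (u : Param d) :
    MeasurePreserving (rotation u) ((stdGaussian (Param d)).prod (gaussianReal 0 1))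
      ((stdGaussian (Param d)).prod (gaussianReal 0 1)) := by
  refine ⟨measurable_rotation u, ?_⟩
  have : IsProbabilityMeasure
      (((stdGaussian (Param d)).prod (gaussianReal 0 1)).map (rotation u)) :=
    Measure.isProbabilityMeasure_map (measurable_rotation u).aemeasurable
  refine charFun_eq_prod_iff.1 fun t => ?_
  have hq := scale_pos u
  -- The adjoint of the rotation, applied to `t`; `h2` below says that it preserves the norm.
  set t' : WithLp 2 (Param d × ℝ) := WithLp.toLp 2
    (shrink u (WithLp.ofLp t).1 - ((WithLp.ofLp t).2 / scale u) • u,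
      ((WithLp.ofLp t).2 + inner ℝ u (WithLp.ofLp t).1) / scale u) with ht'
  have key : ∀ p : Param d × ℝ,
      inner ℝ (WithLp.toLp 2 (rotation u p)) t = (inner ℝ (WithLp.toLp 2 p) t' : ℝ) := by
    intro p
    simp only [WithLp.prod_inner_apply, rotation, ht', inner_add_left, inner_sub_right,
      inner_shrink_left, real_inner_smul_left, real_inner_smul_right]
    simp only [RCLike.inner_apply, conj_trivial]
    rw [real_inner_comm u p.1]
    field_simp
    ring
  have hmeas : Measurable (WithLp.toLp 2 : Param d × ℝ → WithLp 2 (Param d × ℝ)) := by fun_prop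
  have h1 : charFun ((((stdGaussian (Param d)).prod (gaussianReal 0 1)).map (rotation u)).map
      (WithLp.toLp 2)) t =
      charFun (((stdGaussian (Param d)).prod (gaussianReal 0 1)).map (WithLp.toLp 2)) t' := by
    rw [charFun_apply, charFun_apply, Measure.map_map hmeas (measurable_rotation u),
      integral_map (hmeas.comp (measurable_rotation u)).aemeasurable
        (Measurable.aestronglyMeasurable (by fun_prop)),
      integral_map hmeas.aemeasurable (Measurable.aestronglyMeasurable (by fun_prop))]
    simp only [Function.comp_apply, key]
  rw [h1, charFun_prod, charFun_stdGaussian, charFun_gaussianReal, charFun_stdGaussian,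
    charFun_gaussianReal, ← Complex.exp_add, ← Complex.exp_add]
  congr 1
  have h2 : ‖(WithLp.ofLp t').1‖ ^ 2 + (WithLp.ofLp t').2 ^ 2 =
      ‖(WithLp.ofLp t).1‖ ^ 2 + (WithLp.ofLp t).2 ^ 2 := by
    have hs := scale_sq u
    simp only [ht']
    rw [norm_sub_sq_real, norm_shrink_sq, real_inner_smul_right,
      real_inner_comm u (shrink u _), inner_shrink_self, norm_smul, Real.norm_eq_abs, mul_pow, sq_abs]
    have hu : ‖u‖ ^ 2 = scale u ^ 2 - 1 := by rw [hs]; ring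
    rw [hu]
    field_simp
    ring
  have h3 : (‖(WithLp.ofLp t').1‖ ^ 2 + (WithLp.ofLp t').2 ^ 2 : ℂ) =
      ‖(WithLp.ofLp t).1‖ ^ 2 + (WithLp.ofLp t).2 ^ 2 := by exact_mod_cast h2
  simp only [Complex.ofReal_zero, mul_zero, zero_mul, NNReal.coe_one, Complex.ofReal_one, one_mul,
    zero_sub]
  linear_combination (-1 / 2 : ℂ) * h3

/-- The mean `m` and the columns `b` of a square root of the covariance matrix of a Gaussian law on
the parameter space. -/
abbrev GaussState (d : ℕ) : Type := Param d × (Fin d → Param d)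

/-- The linear combination of the vectors `b i` with coefficients `z i`. -/
def comb (b : Fin d → Param d) (z : Param d) : Param d := ∑ i, z i • b i

/-- The adjoint of `comb b`. -/
def coadj (b : Fin d → Param d) (x : Param d) : Param d := WithLp.toLp 2 fun i => inner ℝ (b i) x

theorem inner_comb (b : Fin d → Param d) (z x : Param d) :
    inner ℝ (comb b z) x = (inner ℝ z (coadj b x) : ℝ) := by
  simp only [comb, sum_inner, real_inner_smul_left]
  rw [PiLp.inner_apply]
  exact Finset.sum_congr rfl fun i _ => mul_comm _ _

theorem measurable_comb : Measurable fun p : (Fin d → Param d) × Param d => comb p.1 p.2 := by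
  unfold comb; fun_prop

theorem measurable_coadj : Measurable fun p : (Fin d → Param d) × Param d => coadj p.1 p.2 := by
  unfold coadj; fun_prop

theorem comb_sub_smul (b : Fin d → Param d) (c : ℝ) (y z : Param d) :
    comb b (y - c • z) = comb b y - c • comb b z := by
  simp [comb, sub_smul, Finset.sum_sub_distrib, Finset.smul_sum, mul_smul]

theorem comb_add_smul (b : Fin d → Param d) (c : ℝ) (y z : Param d) :
    comb b (y + c • z) = comb b y + c • comb b z := by
  simp [comb, add_smul, Finset.sum_add_distrib, Finset.smul_sum, mul_smul]

/-- The square root of the covariance matrix after an observation in direction `x`. -/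
def updateCov (b : Fin d → Param d) (x : Param d) : Fin d → Param d := fun i =>
  b i - (shrinkCoef (coadj b x) * coadj b x i) • comb b (coadj b x)

/-- In matrix terms the updated root is `B (1 + u uᵀ)^(-1/2)` with `u = Bᵀ x`, so its square is the
covariance given by the Sherman-Morrison formula. -/
theorem comb_updateCov (b : Fin d → Param d) (x z : Param d) :
    comb (updateCov b x) z = comb b (shrink (coadj b x) z) := by
  rw [shrink, comb_sub_smul]
  conv_lhs => rw [comb]
  simp only [updateCov, smul_sub, Finset.sum_sub_distrib, smul_smul, ← Finset.sum_smul]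
  congr 2
  rw [PiLp.inner_apply, Finset.mul_sum]
  refine Finset.sum_congr rfl fun i _ => ?_
  simp only [RCLike.inner_apply, conj_trivial]
  ring

theorem coadj_updateCov (b : Fin d → Param d) (x y : Param d) :
    coadj (updateCov b x) y = shrink (coadj b x) (coadj b y) := by
  refine ext_inner_left ℝ fun z => ?_
  rw [← inner_comb, comb_updateCov, inner_comb, inner_shrink_left]

/-- The Gaussian law after the observation `r` in direction `x`. -/
def update (s : GaussState d) (x : Param d) (r : ℝ) : GaussState d :=
  (s.1 + ((r - inner ℝ s.1 x) / scale (coadj s.2 x) ^ 2) • comb s.2 (coadj s.2 x),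
    updateCov s.2 x)

theorem measurable_update :
    Measurable fun p : GaussState d × Param d × ℝ => update p.1 p.2.1 p.2.2 := by
  have h1 : Measurable fun p : GaussState d × Param d × ℝ => coadj p.1.2 p.2.1 :=
    measurable_coadj.comp (measurable_fst.snd.prodMk measurable_snd.fst)
  have h2 : Measurable fun p : GaussState d × Param d × ℝ => comb p.1.2 (coadj p.1.2 p.2.1) :=
    measurable_comb.comp (measurable_fst.snd.prodMk h1)
  have h3 : Measurable fun p : GaussState d × Param d × ℝ => scale (coadj p.1.2 p.2.1) := by
    unfold scale; fun_prop
  unfold update updateCov shrinkCoef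
  refine Measurable.prodMk ?_ (measurable_pi_lambda _ fun i => ?_)
  · fun_prop
  · fun_prop

/-- The Gaussian law with mean `m` and covariance `∑ i, b i (b i)ᵀ`. -/
def gaussKernel (d : ℕ) : Kernel (GaussState d) (Param d) :=
  (Kernel.id ×ₖ Kernel.const _ (stdGaussian (Param d))).map
    fun p : GaussState d × Param d => p.1.1 + comb p.1.2 p.2

theorem measurable_affine :
    Measurable fun p : GaussState d × Param d => p.1.1 + comb p.1.2 p.2 :=
  measurable_fst.fst.add (measurable_comb.comp (measurable_fst.snd.prodMk measurable_snd))

instance : IsMarkovKernel (gaussKernel d) := Kernel.IsMarkovKernel.map _ measurable_affine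

theorem lintegral_gaussKernel (s : GaussState d) {F : Param d → ℝ≥0∞} (hF : Measurable F) :
    ∫⁻ μ, F μ ∂gaussKernel d s = ∫⁻ z, F (s.1 + comb s.2 z) ∂stdGaussian (Param d) := by
  have hm : Measurable fun p : GaussState d × Param d => F (p.1.1 + comb p.1.2 p.2) :=
    hF.comp measurable_affine
  rw [gaussKernel, Kernel.lintegral_map _ measurable_affine _ hF, Kernel.lintegral_prod _ _ _ hm,
    Kernel.lintegral_id']
  · simp
  · exact Measurable.lintegral_kernel_prod_right (κ := Kernel.const _ (stdGaussian (Param d))) hm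

theorem lintegral_gaussianReal_one (a : ℝ) {F : ℝ → ℝ≥0∞} (hF : Measurable F) :
    ∫⁻ r, F r ∂gaussianReal a 1 = ∫⁻ w, F (a + w) ∂gaussianReal 0 1 := by
  have h := gaussianReal_map_const_add (μ := 0) (v := 1) a
  rw [zero_add] at h
  rw [← h, lintegral_map hF (by fun_prop)]

/-- Sampling a Gaussian parameter and then a noisy observation of it in direction `x` is the same as
sampling the observation from its marginal law and then the parameter from the updated Gaussian. -/
theorem lintegral_conjugacy (s : GaussState d) (x : Param d) {F : Param d × ℝ → ℝ≥0∞}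
    (hF : Measurable F) :
    ∫⁻ μ, ∫⁻ r, F (μ, r) ∂gaussianReal (inner ℝ μ x) 1 ∂gaussKernel d s =
      ∫⁻ w, ∫⁻ μ, F (μ, inner ℝ s.1 x + scale (coadj s.2 x) * w)
        ∂gaussKernel d (update s x (inner ℝ s.1 x + scale (coadj s.2 x) * w))
        ∂gaussianReal 0 1 := by
  set u := coadj s.2 x with hu
  have hq := scale_pos u
  have hc : Measurable fun z => comb s.2 z := measurable_comb.comp measurable_prodMk_left
  have hm : Measurable fun μ => ∫⁻ r, F (μ, r) ∂gaussianReal (inner ℝ μ x) 1 := by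
    have : Measurable fun μ : Param d => (inner ℝ μ x : ℝ) := by fun_prop
    exact Measurable.lintegral_kernel_prod_right (κ := rewardKernel.comap _ this) hF
  -- The pair is expressed through independent standard Gaussians: `z` for the parameter and `w` for
  -- the noise.
  set G : Param d × ℝ → ℝ≥0∞ := fun p =>
    F (s.1 + comb s.2 p.1, inner ℝ (s.1 + comb s.2 p.1) x + p.2) with hG
  have hGm : Measurable G := by
    refine hF.comp (Measurable.prodMk ?_ ?_) <;> fun_prop
  have hl : ∫⁻ μ, ∫⁻ r, F (μ, r) ∂gaussianReal (inner ℝ μ x) 1 ∂gaussKernel d s =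
      ∫⁻ p, G p ∂((stdGaussian (Param d)).prod (gaussianReal 0 1)) := by
    rw [lintegral_gaussKernel s hm, lintegral_prod _ hGm.aemeasurable]
    refine lintegral_congr fun z => ?_
    have hz : Measurable fun r => F (s.1 + comb s.2 z, r) := hF.comp measurable_prodMk_left
    exact lintegral_gaussianReal_one _ hz
  have hGr : Measurable fun p => G (rotation u p) := hGm.comp (measurable_rotation u)
  rw [hl, ← (measurePreserving_rotation u).lintegral_comp hGm,
    lintegral_prod_symm _ hGr.aemeasurable]
  refine lintegral_congr fun w => ?_
  have hw : Measurable fun μ => F (μ, inner ℝ s.1 x + scale u * w) :=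
    hF.comp measurable_prodMk_right
  rw [lintegral_gaussKernel _ hw]
  refine lintegral_congr fun z => ?_
  -- In rotated coordinates the observation depends on `w` alone (`h2`), while for fixed `w` the
  -- parameter is the updated mean plus the updated root applied to the independent `z`.
  have h1 : s.1 + comb s.2 (rotation u (z, w)).1 =
      (update s x (inner ℝ s.1 x + scale u * w)).1 +
        comb (update s x (inner ℝ s.1 x + scale u * w)).2 z := by
    simp only [rotation, update, comb_updateCov, comb_add_smul, ← hu]
    have : (inner ℝ s.1 x + scale u * w - inner ℝ s.1 x) / scale u ^ 2 = w / scale u := by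
      field_simp; ring
    rw [this]
    abel
  have h2 : inner ℝ (s.1 + comb s.2 (rotation u (z, w)).1) x + (rotation u (z, w)).2 =
      inner ℝ s.1 x + scale u * w := by
    have hs := scale_sq u
    rw [inner_add_left, inner_comb, ← hu]
    simp only [rotation, inner_add_left, real_inner_smul_left, real_inner_self_eq_norm_sq]
    rw [real_inner_comm u (shrink u z), inner_shrink_self]
    have hn : ‖u‖ ^ 2 = scale u ^ 2 - 1 := by rw [hs]; ring
    rw [hn]
    field_simp
    ring
  simp only [hG]
  rw [h2, h1]

/-! ### The log-determinant potential -/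

section Potential

open Matrix

/-- AM-GM for the eigenvalues, proved by bounding `log` by its tangent line at `c` and summing. -/
theorem log_det_le [NeZero d] {V : Matrix (Fin d) (Fin d) ℝ} (hV : V.PosDef) {c : ℝ} (hc : 0 < c)
    (htr : V.trace ≤ d * c) : Real.log V.det ≤ d * Real.log c := by
  have hpos := hV.eigenvalues_pos
  have hdet : V.det = ∏ i, hV.1.eigenvalues i := by
    simpa using! hV.1.det_eq_prod_eigenvalues
  have htrace : V.trace = ∑ i, hV.1.eigenvalues i := by
    simpa using! hV.1.trace_eq_sum_eigenvalues
  rw [hdet, Real.log_prod (fun i _ => (hpos i).ne')]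
  have h : ∀ i, Real.log (hV.1.eigenvalues i) ≤ hV.1.eigenvalues i / c - 1 + Real.log c := by
    intro i
    have := Real.log_le_sub_one_of_pos (div_pos (hpos i) hc)
    rw [Real.log_div (hpos i).ne' hc.ne'] at this
    linarith
  calc ∑ i, Real.log (hV.1.eigenvalues i)
      ≤ ∑ i, (hV.1.eigenvalues i / c - 1 + Real.log c) := Finset.sum_le_sum fun i _ => h i
    _ = V.trace / c - d + d * Real.log c := by
        simp [Finset.sum_add_distrib, Finset.sum_sub_distrib, ← Finset.sum_div, htrace]
    _ ≤ d * Real.log c := by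
        have : V.trace / c ≤ d := (div_le_iff₀ hc).2 htr
        linarith

/-- The invariants that tie a square root `b` of the covariance matrix to the precision matrix `V`,
with log-determinant `D`, of a Gaussian posterior after `n` observations in directions from the unit
ball. -/
structure IsPrecision (b : Fin d → Param d) (D : ℝ) (n : ℕ) (V : Matrix (Fin d) (Fin d) ℝ) :
    Prop where
  posDef : V.PosDef
  trace_le : V.trace ≤ d + n
  conj_eq_one : (Matrix.of fun i j => b i j) * V * (Matrix.of fun i j => b i j)ᵀ = 1
  det_eq : V.det = Real.exp D

theorem of_mulVec_eq_coadj (b : Fin d → Param d) (x : Param d) :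
    (Matrix.of fun i j => b i j) *ᵥ x = coadj b x := by
  ext i
  simp only [mulVec, dotProduct, of_apply, coadj, PiLp.inner_apply, RCLike.inner_apply,
    conj_trivial]
  exact Finset.sum_congr rfl fun j _ => mul_comm _ _

theorem dotProduct_self_eq_norm_sq (u : Param d) :
    (u : Fin d → ℝ) ⬝ᵥ u = ‖u‖ ^ 2 := by
  rw [EuclideanSpace.real_norm_sq_eq, dotProduct]
  exact Finset.sum_congr rfl fun i _ => (sq _).symm

theorem of_updateCov (b : Fin d → Param d) (x : Param d) :
    (Matrix.of fun i j => updateCov b x i j) =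
      (1 - shrinkCoef (coadj b x) • vecMulVec (coadj b x) (coadj b x)) *
        Matrix.of fun i j => b i j := by
  ext i j
  rw [Matrix.sub_mul, Matrix.one_mul, Matrix.smul_mul, vecMulVec_mul]
  simp only [of_apply, Matrix.sub_apply, Matrix.smul_apply, vecMulVec_apply, updateCov,
    PiLp.sub_apply, PiLp.smul_apply, smul_eq_mul, vecMul, dotProduct, comb, WithLp.ofLp_sum,
    Finset.sum_apply, PiLp.smul_apply]
  ring

/-- An observation adds `x xᵀ` to the precision matrix. Conjugation by the old root turns this into
`1 + u uᵀ`, which gives the new determinant by the matrix determinant lemma and is normalised to `1`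
by the factor `(1 + u uᵀ)^(-1/2)` of the new root. -/
theorem IsPrecision.update {b : Fin d → Param d} {D : ℝ} {n : ℕ} {V : Matrix (Fin d) (Fin d) ℝ}
    (h : IsPrecision b D n V) {x : Param d} (hx : ‖x‖ ≤ 1) :
    IsPrecision (updateCov b x) (D + Real.log (1 + ‖coadj b x‖ ^ 2)) (n + 1)
      (V + vecMulVec x x) := by
  set u := coadj b x with hu
  set B : Matrix (Fin d) (Fin d) ℝ := Matrix.of fun i j => b i j with hB
  have hmid : B * (V + vecMulVec x x) * Bᵀ = 1 + vecMulVec u u := by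
    rw [Matrix.mul_add, Matrix.add_mul, h.conj_eq_one, mul_vecMulVec, vecMulVec_mul,
      vecMul_transpose, of_mulVec_eq_coadj]
  have hs : (u : Fin d → ℝ) ⬝ᵥ u = ‖u‖ ^ 2 := dotProduct_self_eq_norm_sq u
  refine ⟨h.posDef.add_posSemidef ?_, ?_, ?_, ?_⟩
  · simpa using! posSemidef_vecMulVec_self_star (R := ℝ) (x : Fin d → ℝ)
  · rw [trace_add, trace_vecMulVec, dotProduct_self_eq_norm_sq]
    have := h.trace_le
    push_cast
    nlinarith [norm_nonneg x]
  · rw [of_updateCov, ← hu, transpose_mul]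
    set M := (1 : Matrix (Fin d) (Fin d) ℝ) - shrinkCoef u • vecMulVec u u with hM
    have hMt : Mᵀ = M := by
      rw [hM, transpose_sub, transpose_one, transpose_smul, transpose_vecMulVec]
    have hassoc : M * B * (V + vecMulVec x x) * (Bᵀ * Mᵀ) =
        M * (B * (V + vecMulVec x x) * Bᵀ) * M := by
      rw [hMt]; simp only [Matrix.mul_assoc]
    rw [hassoc, hmid]
    have huu : vecMulVec (u : Fin d → ℝ) u * vecMulVec u u =
        ‖u‖ ^ 2 • vecMulVec (u : Fin d → ℝ) u := by
      rw [vecMulVec_mul_vecMulVec, hs]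
      ext i j
      simp only [vecMulVec_apply, Matrix.smul_apply, Pi.smul_apply, smul_eq_mul]
      ring
    have hc := one_sub_shrinkCoef_mul u
    have hq := scale_pos u
    have hq2 := scale_sq u
    set c := shrinkCoef u
    have key : (1 - c * ‖u‖ ^ 2) ^ 2 * (1 + ‖u‖ ^ 2) = 1 := by
      rw [hc, ← hq2]; field_simp
    set W := vecMulVec (u : Fin d → ℝ) u
    have hexp : M * (1 + W) * M = 1 +
        ((1 - 2 * c) + (c ^ 2 - 2 * c) * ‖u‖ ^ 2 + c ^ 2 * ‖u‖ ^ 2 * ‖u‖ ^ 2) • W := by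
      simp only [hM, Matrix.sub_mul, Matrix.mul_sub, Matrix.mul_add, Matrix.add_mul, Matrix.one_mul,
        Matrix.mul_one, Matrix.smul_mul, Matrix.mul_smul, huu, smul_smul]
      module
    rw [hexp]
    -- `key` yields the vanishing of the coefficient only after multiplication by `‖u‖ ^ 2`; for `u
    -- = 0` the matrix `W` vanishes instead.
    by_cases hu0 : ‖u‖ = 0
    · have : (u : Param d) = 0 := norm_eq_zero.1 hu0
      have hW : W = 0 := by
        simp only [W, this]
        ext i j
        simp [vecMulVec_apply]
      rw [hW, smul_zero, add_zero]
    · have : ((1 - 2 * c) + (c ^ 2 - 2 * c) * ‖u‖ ^ 2 + c ^ 2 * ‖u‖ ^ 2 * ‖u‖ ^ 2) = 0 := by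
        have h2 : ‖u‖ ^ 2 * ((1 - 2 * c) + (c ^ 2 - 2 * c) * ‖u‖ ^ 2
            + c ^ 2 * ‖u‖ ^ 2 * ‖u‖ ^ 2) = 0 := by
          linear_combination key
        exact (mul_eq_zero.1 h2).resolve_left (by positivity)
      rw [this, zero_smul, add_zero]
  · have h1 : B.det * V.det * B.det = 1 := by
      have := congrArg Matrix.det h.conj_eq_one
      rwa [det_mul, det_mul, det_transpose, det_one] at this
    have h2 : B.det * (V + vecMulVec x x).det * B.det = 1 + ‖u‖ ^ 2 := by
      have := congrArg Matrix.det hmid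
      rw [det_mul, det_mul, det_transpose, vecMulVec_eq Unit u,
        det_one_add_replicateCol_mul_replicateRow, hs] at this
      exact this
    have h0 : B.det ≠ 0 := by
      intro h0
      simp [h0] at h1
    rw [Real.exp_add, Real.exp_log (by positivity), ← h.det_eq]
    have : B.det * B.det * ((V + vecMulVec x x).det - V.det * (1 + ‖u‖ ^ 2)) = 0 := by
      linear_combination h2 - (1 + ‖u‖ ^ 2) * h1
    have h3 := (mul_eq_zero.1 this).resolve_left (mul_ne_zero h0 h0)
    linarith

theorem isPrecision_zero :
    IsPrecision (fun i : Fin d => EuclideanSpace.single i 1) 0 0 1 := by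
  refine ⟨PosDef.one, by simp, ?_, by simp⟩
  have : (Matrix.of fun i j => (EuclideanSpace.single i (1 : ℝ) : Param d) j) = 1 := by
    ext i j
    simp [Matrix.one_apply, eq_comm]
  rw [this]
  simp

theorem IsPrecision.le_log [NeZero d] {b : Fin d → Param d} {D : ℝ} {n : ℕ}
    {V : Matrix (Fin d) (Fin d) ℝ} (h : IsPrecision b D n V) : D ≤ d * Real.log (1 + n) := by
  -- The trace bound `d + n` is weakened to `d (1 + n)`, which uses `d ≥ 1`.
  have h1 := log_det_le h.posDef (c := 1 + n) (by positivity) (by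
    have hd : (1 : ℝ) ≤ d := by exact_mod_cast NeZero.one_le
    have := h.trace_le
    nlinarith [(Nat.cast_nonneg n : (0 : ℝ) ≤ n)])
  rwa [h.det_eq, Real.log_exp] at h1

end Potential

/-! ### The Gaussian posterior as a function of the history -/

/-- The vector itself if it lies in the unit ball, and `0` otherwise. -/
def clip (x : Param d) : Param d := if ‖x‖ ≤ 1 then x else 0

theorem norm_clip_le (x : Param d) : ‖clip x‖ ≤ 1 := by
  unfold clip
  split_ifs with h
  · exact h
  · simp

theorem clip_of_norm_le {x : Param d} (hx : ‖x‖ ≤ 1) : clip x = x := if_pos hx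

theorem measurable_clip : Measurable (clip (d := d)) :=
  Measurable.ite (measurableSet_le measurable_norm measurable_const) measurable_id measurable_const

/-- The context vector of the arm that is played in a round, clipped to the unit ball. -/
def played (r : Round d K) : Param d := clip (r.1 r.2.2.1)

theorem measurable_played : Measurable (played (d := d) (K := K)) := by
  have h : Measurable fun q : Contexts d K × Fin K => q.1 q.2 :=
    measurable_from_prod_countable_left fun a => measurable_pi_apply a
  exact measurable_clip.comp (h.comp (measurable_fst.prodMk measurable_snd.snd.fst))

/-- The mean and a square root of the covariance of the Gaussian posterior given the history. -/
def posteriorState : (n : ℕ) → Hist d K n → GaussState d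
  | 0, _ => (0, fun i => EuclideanSpace.single i 1)
  | n + 1, h => update (posteriorState n (Fin.init h)) (played (h (Fin.last n)))
      (h (Fin.last n)).2.2.2

/-- The log-determinant of the precision matrix of the Gaussian posterior given the history. -/
def logDet : (n : ℕ) → Hist d K n → ℝ
  | 0, _ => 0
  | n + 1, h => logDet n (Fin.init h) +
      Real.log (1 + ‖coadj (posteriorState n (Fin.init h)).2 (played (h (Fin.last n)))‖ ^ 2)

theorem posteriorState_append (n : ℕ) (h : Hist d K n) (r : Round d K) :
    posteriorState (n + 1) (append n (h, r)) = update (posteriorState n h) (played r) r.2.2.2 := by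
  simp [posteriorState, append]

theorem logDet_append (n : ℕ) (h : Hist d K n) (r : Round d K) :
    logDet (n + 1) (append n (h, r)) =
      logDet n h + Real.log (1 + ‖coadj (posteriorState n h).2 (played r)‖ ^ 2) := by
  simp [logDet, append]

theorem measurable_init (n : ℕ) :
    Measurable fun h : Hist d K (n + 1) => (Fin.init h : Hist d K n) :=
  measurable_pi_lambda _ fun i => measurable_pi_apply i.castSucc

theorem measurable_posteriorState : ∀ n, Measurable (posteriorState (d := d) (K := K) n)
  | 0 => measurable_const
  | n + 1 => by
    have hl : Measurable fun h : Hist d K (n + 1) => h (Fin.last n) := measurable_pi_apply _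
    exact measurable_update.comp (((measurable_posteriorState n).comp (measurable_init n)).prodMk
      ((measurable_played.comp hl).prodMk hl.snd.snd.snd))

theorem measurable_logDet : ∀ n, Measurable (logDet (d := d) (K := K) n)
  | 0 => measurable_const
  | n + 1 => by
    have hl : Measurable fun h : Hist d K (n + 1) => h (Fin.last n) := measurable_pi_apply _
    have h1 : Measurable fun h : Hist d K (n + 1) =>
        coadj (posteriorState n (Fin.init h)).2 (played (h (Fin.last n))) :=
      measurable_coadj.comp (((measurable_posteriorState n).comp (measurable_init n)).snd.prodMk
        (measurable_played.comp hl))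
    exact ((measurable_logDet n).comp (measurable_init n)).add
      (Real.measurable_log.comp ((h1.norm.pow_const 2).const_add 1))

/-- Contexts lie in the unit ball only almost surely; the clipping in `played` makes the invariants,
and hence `logDet_le`, hold for every history. -/
theorem exists_isPrecision : ∀ (n : ℕ) (h : Hist d K n),
    ∃ V, IsPrecision (posteriorState n h).2 (logDet n h) n V
  | 0, _ => ⟨1, by simpa [posteriorState, logDet] using isPrecision_zero⟩
  | n + 1, h => by
    obtain ⟨V, hV⟩ := exists_isPrecision n (Fin.init h)
    exact ⟨_, hV.update (norm_clip_le _)⟩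

theorem logDet_le [NeZero d] (n : ℕ) (h : Hist d K n) : logDet n h ≤ d * Real.log (1 + n) := by
  obtain ⟨V, hV⟩ := exists_isPrecision n h
  exact hV.le_log

theorem logDet_nonneg : ∀ (n : ℕ) (h : Hist d K n), 0 ≤ logDet n h
  | 0, _ => le_rfl
  | n + 1, _ => add_nonneg (logDet_nonneg n _)
      (Real.log_nonneg (le_add_of_nonneg_right (sq_nonneg _)))

/-- Observations can only decrease the variance in a direction, because `shrink` is a contraction.
-/
theorem norm_coadj_posteriorState_le : ∀ (n : ℕ) (h : Hist d K n) (x : Param d),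
    ‖coadj (posteriorState n h).2 x‖ ≤ ‖x‖
  | 0, _, x => by
    have : coadj (fun i : Fin d => EuclideanSpace.single i (1 : ℝ)) x = x := by
      ext i
      simp [coadj, EuclideanSpace.inner_single_left]
    simp [posteriorState, this]
  | n + 1, h, x => by
    simp only [posteriorState, update, coadj_updateCov]
    exact (norm_shrink_le _ _).trans (norm_coadj_posteriorState_le n _ x)

/-- The Gaussian posterior given the history, as a kernel. -/
def gaussPosterior (n : ℕ) : Kernel (Hist d K n) (Param d) :=
  (gaussKernel d).comap (posteriorState n) (measurable_posteriorState n)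

instance (n : ℕ) : IsMarkovKernel (gaussPosterior (d := d) (K := K) n) := by
  unfold gaussPosterior; infer_instance

/-! ### Integration against the law of a round -/

theorem lintegral_armKernel (f : MeritFunction) (p : Contexts d K × Param d)
    (F : Fin K → ℝ≥0∞) :
    ∫⁻ a, F a ∂armKernel f p = ∑ a, ENNReal.ofReal (fairPolicy f p.1 p.2 a) * F a := by
  change ∫⁻ a, F a ∂(∑ a, ENNReal.ofReal (fairPolicy f p.1 p.2 a) • Measure.dirac a) = _
  simp

/-- The integral of `F` over the arm and the reward of a round, given the true parameter `μ`, the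
contexts `x` and the sampled parameter `θ`. -/
def playIntegral (f : MeritFunction) (F : Param d × Round d K → ℝ≥0∞) (μ : Param d)
    (x : Contexts d K) (θ : Param d) : ℝ≥0∞ :=
  ∑ a, ENNReal.ofReal (fairPolicy f x θ a) *
    ∫⁻ r, F (μ, x, fairPolicy f x θ, a, r) ∂gaussianReal (inner ℝ μ (x a)) 1

theorem measurable_playIntegrand (f : MeritFunction) (a : Fin K) :
    Measurable fun q : (Param d × Contexts d K × Param d) × ℝ =>
      ((q.1.1, q.1.2.1, fairPolicy f q.1.2.1 q.1.2.2, a, q.2) : Param d × Round d K) := by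
  refine measurable_fst.fst.prodMk (measurable_fst.snd.fst.prodMk (Measurable.prodMk ?_
    (measurable_const.prodMk measurable_snd)))
  exact measurable_pi_lambda _ fun b => (measurable_fairPolicy f b).comp measurable_fst.snd

theorem measurable_playIntegral (f : MeritFunction) {F : Param d × Round d K → ℝ≥0∞}
    (hF : Measurable F) :
    Measurable fun p : Param d × Contexts d K × Param d => playIntegral f F p.1 p.2.1 p.2.2 := by
  refine Finset.measurable_sum _ fun a _ => ?_
  refine ((measurable_fairPolicy f a).comp measurable_snd).ennreal_ofReal.mul ?_
  have h : Measurable fun p : Param d × Contexts d K × Param d => (inner ℝ p.1 (p.2.1 a) : ℝ) :=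
    measurable_fst.inner ((measurable_pi_apply a).comp measurable_snd.fst)
  exact (hF.comp (measurable_playIntegrand f a)).lintegral_kernel_prod_right'
    (κ := rewardKernel.comap _ h)

theorem lintegral_roundKernel [NeZero K] {n : ℕ} (f : MeritFunction)
    (ctx : Kernel (Hist d K n) (Contexts d K)) [IsMarkovKernel ctx]
    (post : Kernel (Hist d K n) (Param d)) [IsMarkovKernel post] (μ : Param d) (h : Hist d K n)
    {F : Param d × Round d K → ℝ≥0∞} (hF : Measurable F) :
    ∫⁻ r, F (μ, r) ∂roundKernel f ctx post (μ, h) =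
      ∫⁻ x, ∫⁻ θ, playIntegral f F μ x θ ∂post h ∂ctx h := by
  have hmap : Measurable fun q : ((Contexts d K × Param d) × Fin K) × ℝ =>
      ((q.1.1.1, fairPolicy f q.1.1.1 q.1.1.2, q.1.2, q.2) : Round d K) :=
    measurable_fst.fst.fst.prodMk
      ((measurable_pi_lambda _ fun a => (measurable_fairPolicy f a).comp measurable_fst.fst).prodMk
        (measurable_fst.snd.prodMk measurable_snd))
  have hFμ : Measurable fun r => F (μ, r) := hF.comp measurable_prodMk_left
  have h1 : Measurable fun q : ((Contexts d K × Param d) × Fin K) × ℝ =>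
      F (μ, q.1.1.1, fairPolicy f q.1.1.1 q.1.1.2, q.1.2, q.2) := hFμ.comp hmap
  have hin : Measurable fun q : (Contexts d K × Param d) × Fin K =>
      (inner ℝ μ (q.1.1 q.2) : ℝ) :=
    measurable_meanReward measurable_const measurable_fst.fst measurable_snd
  have h2 : Measurable fun q : (Contexts d K × Param d) × Fin K =>
      ∫⁻ r, F (μ, q.1.1, fairPolicy f q.1.1 q.1.2, q.2, r) ∂gaussianReal (inner ℝ μ (q.1.1 q.2)) 1 :=
    h1.lintegral_kernel_prod_right' (κ := rewardKernel.comap _ hin)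
  have hp : Measurable fun q : Contexts d K × Param d => (μ, q) := measurable_prodMk_left
  have h3 : Measurable fun q : Contexts d K × Param d => playIntegral f F μ q.1 q.2 := by
    have := (measurable_playIntegral f hF).comp hp
    simpa only [Function.comp_def] using this
  rw [roundKernel, Kernel.lintegral_map _ hmap _ hFμ]
  refine (Kernel.lintegral_compProd _ _ _ h1).trans ?_
  refine (Kernel.lintegral_compProd _ _ _ h2).trans ?_
  simp only [Kernel.lintegral_comap, lintegral_armKernel]
  exact Kernel.lintegral_prod ctx post h h3

/-! ### The regret of one round -/

/-- Changing the numerators and changing the normalisation each cost at most the same sum. It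
matters that only the normaliser of `G` appears on the right: with `G` the merits for the sampled
parameter, the bound becomes an average under the deployed policy. -/
theorem sum_abs_div_sum_sub_le {F G : Fin K → ℝ} (hF : ∀ a, 0 < F a) (hG : ∀ a, 0 < G a) :
    ∑ a, |F a / ∑ b, F b - G a / ∑ b, G b| ≤ 2 * ∑ a, |F a - G a| / ∑ b, G b := by
  rcases isEmpty_or_nonempty (Fin K) with hK | hK
  · simp
  have hSF : 0 < ∑ b, F b := Finset.sum_pos (fun b _ => hF b) Finset.univ_nonempty
  have hSG : 0 < ∑ b, G b := Finset.sum_pos (fun b _ => hG b) Finset.univ_nonempty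
  set SF := ∑ b, F b with hSFd
  set SG := ∑ b, G b with hSGd
  have h1 : ∀ a, |F a / SF - G a / SG| ≤ |F a - G a| / SG + F a / SF * (|SG - SF| / SG) := by
    intro a
    have : F a / SF - G a / SG = (F a - G a) / SG + F a / SF * ((SG - SF) / SG) := by
      field_simp; ring
    rw [this]
    refine (abs_add_le _ _).trans (le_of_eq ?_)
    rw [abs_div, abs_mul, abs_div (SG - SF), abs_of_pos hSG, abs_of_pos (div_pos (hF a) hSF)]
  have h2 : |SG - SF| ≤ ∑ a, |F a - G a| := by
    rw [hSFd, hSGd, ← Finset.sum_sub_distrib]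
    refine (Finset.abs_sum_le_sum_abs _ _).trans (le_of_eq ?_)
    exact Finset.sum_congr rfl fun a _ => abs_sub_comm _ _
  calc ∑ a, |F a / SF - G a / SG|
      ≤ ∑ a, (|F a - G a| / SG + F a / SF * (|SG - SF| / SG)) := Finset.sum_le_sum fun a _ => h1 a
    _ = ∑ a, |F a - G a| / SG + |SG - SF| / SG := by
        rw [Finset.sum_add_distrib, ← Finset.sum_mul, ← Finset.sum_div Finset.univ F,
          div_self hSF.ne', one_mul]
    _ ≤ 2 * ∑ a, |F a - G a| / SG := by
        rw [← Finset.sum_div, two_mul]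
        gcongr

theorem sum_abs_fairPolicy_sub_le (f : MeritFunction) {L γ : ℝ} (hL : 0 < L) (hγ : 0 < γ)
    (hf : ∀ x, γ ≤ f.merit x) (hLip : ∀ x y, |f.merit x - f.merit y| ≤ L * |x - y|)
    (x : Contexts d K) (μ θ : Param d) :
    ∑ a, |fairPolicy f x μ a - fairPolicy f x θ a| ≤
      2 * L / γ * ∑ a, fairPolicy f x θ a * |inner ℝ (μ - θ) (x a)| := by
  refine (sum_abs_div_sum_sub_le (fun a => f.merit_pos _) fun a => f.merit_pos _).trans ?_
  rw [Finset.mul_sum, Finset.mul_sum]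
  refine Finset.sum_le_sum fun a _ => ?_
  have hS : 0 ≤ ∑ b, f.merit (inner ℝ θ (x b)) := Finset.sum_nonneg fun b _ => (f.merit_pos _).le
  have h1 := hLip (inner ℝ μ (x a)) (inner ℝ θ (x a))
  rw [← inner_sub_left] at h1
  -- The factor `f / γ ≥ 1` is inserted so that, after division by the normaliser, the policy weight
  -- of the arm appears.
  have h2 : L * |inner ℝ (μ - θ) (x a)| ≤
      L / γ * f.merit (inner ℝ θ (x a)) * |inner ℝ (μ - θ) (x a)| := by
    gcongr
    rw [div_mul_eq_mul_div, le_div_iff₀ hγ]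
    gcongr
    exact hf _
  calc 2 * (|f.merit (inner ℝ μ (x a)) - f.merit (inner ℝ θ (x a))| /
        ∑ b, f.merit (inner ℝ θ (x b)))
      ≤ 2 * ((L / γ * f.merit (inner ℝ θ (x a)) * |inner ℝ (μ - θ) (x a)|) /
        ∑ b, f.merit (inner ℝ θ (x b))) := by
        gcongr
        exact h1.trans h2
    _ = 2 * L / γ * (fairPolicy f x θ a * |inner ℝ (μ - θ) (x a)|) := by
        unfold fairPolicy; ring

/-- The left side is `‖u‖ |y|` with `y` the component of `z` along `u`. AM-GM separates the
variance, comparable to its logarithm on the unit ball, from `y²`. The parameter `k` will be the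
number of arms: a sum of `k` exponentials with bounded mean, divided by `k`, stays bounded in mean.
-/
theorem abs_inner_le_of_norm_le_one {z u : Param d} (hu : ‖u‖ ≤ 1) {l k : ℝ} (hl : 0 < l)
    (hk : 0 < k) :
    |(inner ℝ z u : ℝ)| ≤ l * Real.log (1 + ‖u‖ ^ 2) +
      2 / l * (Real.log k + Real.exp ((inner ℝ z (‖u‖⁻¹ • u)) ^ 2 / 4) / k) := by
  set y : ℝ := inner ℝ z (‖u‖⁻¹ • u) with hy
  have h1 : (inner ℝ z u : ℝ) = ‖u‖ * y := by
    rw [hy, real_inner_smul_right]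
    by_cases h0 : ‖u‖ = 0
    · rw [norm_eq_zero.1 h0]; simp
    · field_simp
  -- From `1 + s ≤ exp s` at `s = y ^ 2 / 4 - log k`.
  have h2 : y ^ 2 / 4 ≤ Real.log k + Real.exp (y ^ 2 / 4) / k := by
    have := Real.add_one_le_exp (y ^ 2 / 4 - Real.log k)
    rw [Real.exp_sub, Real.exp_log hk] at this
    linarith
  -- From `log (1 + s) ≥ s / (1 + s) ≥ s / 2` for `0 ≤ s ≤ 1`.
  have h3 : ‖u‖ ^ 2 ≤ 2 * Real.log (1 + ‖u‖ ^ 2) := by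
    have hs : 0 < 1 + ‖u‖ ^ 2 := by positivity
    have h := Real.one_sub_inv_le_log_of_pos hs
    have hs1 : ‖u‖ ^ 2 ≤ 1 := pow_le_one₀ (norm_nonneg _) hu
    have : ‖u‖ ^ 2 / 2 ≤ 1 - (1 + ‖u‖ ^ 2)⁻¹ := by
      rw [← sub_nonneg]
      have : 1 - (1 + ‖u‖ ^ 2)⁻¹ - ‖u‖ ^ 2 / 2 = ‖u‖ ^ 2 * (1 - ‖u‖ ^ 2) / (2 * (1 + ‖u‖ ^ 2)) := by
        field_simp; ring
      rw [this]
      have : 0 ≤ 1 - ‖u‖ ^ 2 := by linarith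
      positivity
    linarith
  have h4 : ‖u‖ * |y| ≤ l * (‖u‖ ^ 2 / 2) + 2 / l * (y ^ 2 / 4) := by
    have : l * (‖u‖ ^ 2 / 2) + 2 / l * (y ^ 2 / 4) - ‖u‖ * |y| = (l * ‖u‖ - |y|) ^ 2 / (2 * l) := by
      rw [← sq_abs y]
      field_simp; ring
    have h5 : 0 ≤ (l * ‖u‖ - |y|) ^ 2 / (2 * l) := by positivity
    linarith
  rw [h1, abs_mul, abs_norm]
  refine h4.trans (add_le_add ?_ ?_)
  · gcongr; linarith
  · gcongr

/-- The exponent `1/4` is below the critical `1/2`, and the integral equals `√2`. -/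
theorem lintegral_exp_sq_gaussianReal :
    ∫⁻ y, ENNReal.ofReal (Real.exp (y ^ 2 / 4)) ∂gaussianReal 0 1 ≤ 2 := by
  rw [gaussianReal_of_var_ne_zero 0 one_ne_zero,
    lintegral_withDensity_eq_lintegral_mul _ (measurable_gaussianPDF 0 1) (by fun_prop)]
  have h : ∀ y : ℝ, (gaussianPDF 0 1 * fun y => ENNReal.ofReal (Real.exp (y ^ 2 / 4))) y =
      ENNReal.ofReal ((√(2 * Real.pi))⁻¹ * Real.exp (-(1 / 4) * y ^ 2)) := by
    intro y
    rw [Pi.mul_apply, gaussianPDF, ← ENNReal.ofReal_mul (gaussianPDFReal_nonneg _ _ _),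
      gaussianPDFReal, mul_assoc, ← Real.exp_add]
    congr 3
    · simp
    · simp; ring
  simp_rw [h]
  rw [← ofReal_integral_eq_lintegral_ofReal
    ((integrable_exp_neg_mul_sq (by norm_num)).const_mul _) (ae_of_all _ fun y => by positivity),
    integral_const_mul, integral_gaussian]
  refine ENNReal.ofReal_le_of_le_toReal ?_
  have hpi := Real.pi_pos
  rw [show Real.pi / (1 / 4) = 2 * (2 * Real.pi) by ring, Real.sqrt_mul zero_le_two (2 * Real.pi)]
  have h0 : √(2 * Real.pi) ≠ 0 := (Real.sqrt_pos.2 (by positivity)).ne'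
  have h2 : √2 ≤ 2 := by
    rw [Real.sqrt_le_left (by norm_num)]; norm_num
  rw [mul_left_comm, inv_mul_cancel₀ h0, mul_one]
  simp [h2]

theorem lintegral_exp_inner_sq_le (u : Param d) :
    ∫⁻ z, ENNReal.ofReal (Real.exp ((inner ℝ z (‖u‖⁻¹ • u)) ^ 2 / 4)) ∂stdGaussian (Param d) ≤
      2 := by
  -- Here the normalised direction is `0` and the integrand is `1`.
  by_cases h0 : u = 0
  · simp [h0]
  set v : Param d := ‖u‖⁻¹ • u with hv
  have hv1 : ‖v‖ = 1 := by
    rw [hv, norm_smul, norm_inv, norm_norm, inv_mul_cancel₀ (norm_ne_zero_iff.2 h0)]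
  have hmap : (stdGaussian (Param d)).map (innerSL ℝ v) = gaussianReal 0 1 := by
    rw [IsGaussian.map_eq_gaussianReal, variance_dual_stdGaussian,
      integral_strongDual_stdGaussian, innerSL_apply_norm, hv1]
    simp
  have hm : Measurable fun y : ℝ => ENNReal.ofReal (Real.exp (y ^ 2 / 4)) := by fun_prop
  have h := lintegral_exp_sq_gaussianReal
  rw [← hmap, lintegral_map hm (by fun_prop)] at h
  refine le_of_eq_of_le (lintegral_congr fun z => ?_) h
  rw [innerSL_apply_apply, real_inner_comm]

theorem sum_abs_fairPolicy_sub_le_exp [NeZero K] (f : MeritFunction) {L γ l : ℝ} (hL : 0 < L)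
    (hγ : 0 < γ) (hl : 0 < l) (hf : ∀ x, γ ≤ f.merit x)
    (hLip : ∀ x y, |f.merit x - f.merit y| ≤ L * |x - y|) (s : GaussState d) {x : Contexts d K}
    (hx : ∀ a, ‖coadj s.2 (x a)‖ ≤ 1) (z z' : Param d) :
    ∑ a, |fairPolicy f x (s.1 + comb s.2 z) a - fairPolicy f x (s.1 + comb s.2 z') a| ≤
      ∑ a, fairPolicy f x (s.1 + comb s.2 z') a *
          (4 * L * l / γ * Real.log (1 + ‖coadj s.2 (x a)‖ ^ 2)) +
        8 * L / (γ * l) * Real.log K +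
        4 * L / (γ * l) / K * ∑ a,
          (Real.exp ((inner ℝ z (‖coadj s.2 (x a)‖⁻¹ • coadj s.2 (x a))) ^ 2 / 4) +
            Real.exp ((inner ℝ z' (‖coadj s.2 (x a)‖⁻¹ • coadj s.2 (x a))) ^ 2 / 4)) := by
  set p := fairPolicy f x (s.1 + comb s.2 z') with hp
  have hp0 : ∀ a, 0 ≤ p a := fairPolicy_nonneg f x _
  have hp1 : ∑ a, p a = 1 := sum_fairPolicy f x _
  have hK : (0 : ℝ) < K := by exact_mod_cast Nat.pos_of_ne_zero (NeZero.ne K)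
  set E : Fin K → ℝ := fun a =>
    Real.exp ((inner ℝ z (‖coadj s.2 (x a)‖⁻¹ • coadj s.2 (x a))) ^ 2 / 4) +
      Real.exp ((inner ℝ z' (‖coadj s.2 (x a)‖⁻¹ • coadj s.2 (x a))) ^ 2 / 4) with hE
  have hE0 : ∀ a, 0 ≤ E a := fun a => by positivity
  have h1 : ∀ a, |(inner ℝ (s.1 + comb s.2 z - (s.1 + comb s.2 z')) (x a) : ℝ)| ≤
      2 * l * Real.log (1 + ‖coadj s.2 (x a)‖ ^ 2) + 4 / l * Real.log K + 2 / l / K * E a := by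
    intro a
    rw [add_sub_add_left_eq_sub, inner_sub_left, inner_comb, inner_comb]
    refine (abs_sub _ _).trans ?_
    refine (add_le_add (abs_inner_le_of_norm_le_one (hx a) hl hK)
      (abs_inner_le_of_norm_le_one (hx a) hl hK)).trans (le_of_eq ?_)
    simp only [hE]
    ring
  -- The weights `p a` depend on `z'`. Bounding them by `1` removes this dependence; the factor `1 /
  -- K` in front absorbs the sum over all arms.
  have h2 : ∑ a, p a * E a ≤ ∑ a, E a := Finset.sum_le_sum fun a _ =>
    mul_le_of_le_one_left (hE0 a) (hp1 ▸ Finset.single_le_sum (fun b _ => hp0 b) (Finset.mem_univ a))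
  calc _ ≤ 2 * L / γ * ∑ a, p a * |inner ℝ (s.1 + comb s.2 z - (s.1 + comb s.2 z')) (x a)| :=
        sum_abs_fairPolicy_sub_le f hL hγ hf hLip x _ _
    _ ≤ 2 * L / γ * ∑ a, p a * (2 * l * Real.log (1 + ‖coadj s.2 (x a)‖ ^ 2) +
          4 / l * Real.log K + 2 / l / K * E a) := by
        gcongr with a
        · exact hp0 a
        · exact h1 a
    _ = ∑ a, p a * (4 * L * l / γ * Real.log (1 + ‖coadj s.2 (x a)‖ ^ 2)) +
        8 * L / (γ * l) * Real.log K * (∑ a, p a) +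
        4 * L / (γ * l) / K * ∑ a, p a * E a := by
        simp only [Finset.mul_sum, ← Finset.sum_add_distrib]
        refine Finset.sum_congr rfl fun a _ => ?_
        field_simp
        ring
    _ ≤ _ := by
        rw [hp1, mul_one]
        gcongr

/-- The expected regret of one round of posterior sampling is at most the expected increase of the
log-determinant potential, up to a term of order `log K`. -/
theorem lintegral_sum_abs_fairPolicy_sub_le [NeZero K] (f : MeritFunction) {L γ l : ℝ} (hL : 0 < L)
    (hγ : 0 < γ) (hl : 0 < l) (hf : ∀ x, γ ≤ f.merit x)
    (hLip : ∀ x y, |f.merit x - f.merit y| ≤ L * |x - y|) (s : GaussState d) {x : Contexts d K}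
    (hx : ∀ a, ‖coadj s.2 (x a)‖ ≤ 1) :
    ∫⁻ μ, ∫⁻ θ, ENNReal.ofReal (∑ a, |fairPolicy f x μ a - fairPolicy f x θ a|)
        ∂gaussKernel d s ∂gaussKernel d s ≤
      ∫⁻ θ, ∑ a, ENNReal.ofReal (fairPolicy f x θ a) *
          ENNReal.ofReal (4 * L * l / γ * Real.log (1 + ‖coadj s.2 (x a)‖ ^ 2))
        ∂gaussKernel d s + ENNReal.ofReal (8 * L / (γ * l) * (Real.log K + 2)) := by
  have hK : (0 : ℝ) < K := by exact_mod_cast Nat.pos_of_ne_zero (NeZero.ne K)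
  have hK1 : (1 : ℝ) ≤ K := by exact_mod_cast NeZero.one_le
  have hfp : ∀ a, Measurable fun θ : Param d => fairPolicy f x θ a := fun a =>
    (measurable_fairPolicy f a).comp measurable_prodMk_left
  have hpair : Measurable fun p : Param d × Param d =>
      ENNReal.ofReal (∑ a, |fairPolicy f x p.1 a - fairPolicy f x p.2 a|) := by
    refine (Finset.measurable_sum _ fun a _ => ?_).ennreal_ofReal
    have h := ((hfp a).comp (measurable_fst (α := Param d) (β := Param d))).sub
      ((hfp a).comp measurable_snd)
    exact measurable_norm.comp h
  set w : Fin K → ℝ := fun a => 4 * L * l / γ * Real.log (1 + ‖coadj s.2 (x a)‖ ^ 2) with hw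
  have hw0 : ∀ a, 0 ≤ w a := fun a => by
    have : 0 ≤ Real.log (1 + ‖coadj s.2 (x a)‖ ^ 2) :=
      Real.log_nonneg (le_add_of_nonneg_right (sq_nonneg _))
    positivity
  set e : Fin K → Param d → ℝ := fun a z =>
    Real.exp ((inner ℝ z (‖coadj s.2 (x a)‖⁻¹ • coadj s.2 (x a))) ^ 2 / 4) with he
  have he0 : ∀ a z, 0 ≤ e a z := fun a z => (Real.exp_pos _).le
  have hem : ∀ a, Measurable fun z => ENNReal.ofReal (e a z) := fun a => by fun_prop
  have hint : ∀ a, ∫⁻ z, ENNReal.ofReal (e a z) ∂stdGaussian (Param d) ≤ 2 := fun a =>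
    lintegral_exp_inner_sq_le _
  set c := 4 * L / (γ * l) / K with hc
  have hc0 : 0 ≤ c := by positivity
  have hΨ : Measurable fun θ : Param d =>
      ∑ a, ENNReal.ofReal (fairPolicy f x θ a) * ENNReal.ofReal (w a) :=
    Finset.measurable_sum _ fun a _ => (hfp a).ennreal_ofReal.mul_const _
  set Ψ : Param d → ℝ≥0∞ := fun θ =>
      ∑ a, ENNReal.ofReal (fairPolicy f x θ a) * ENNReal.ofReal (w a) with hΨd
  set S : Param d → ℝ≥0∞ := fun z => ∑ a, ENNReal.ofReal (e a z) with hS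
  have hSm : Measurable S := Finset.measurable_sum _ fun a _ => hem a
  have hSint : ∫⁻ z, S z ∂stdGaussian (Param d) ≤ K * 2 := by
    rw [hS, lintegral_finsetSum _ fun a _ => hem a]
    refine (Finset.sum_le_sum fun a _ => hint a).trans (by simp)
  have hlog : 0 ≤ Real.log K := Real.log_nonneg hK1
  set A := ENNReal.ofReal (8 * L / (γ * l) * Real.log K) with hA
  have hpt : ∀ z z', ENNReal.ofReal (∑ a, |fairPolicy f x (s.1 + comb s.2 z) a -
      fairPolicy f x (s.1 + comb s.2 z') a|) ≤
      (Ψ (s.1 + comb s.2 z') + A + ENNReal.ofReal c * S z') + ENNReal.ofReal c * S z := by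
    intro z z'
    refine (ENNReal.ofReal_le_ofReal
      (sum_abs_fairPolicy_sub_le_exp f hL hγ hl hf hLip s hx z z')).trans (le_of_eq ?_)
    have hsum : Ψ (s.1 + comb s.2 z') =
        ENNReal.ofReal (∑ a, fairPolicy f x (s.1 + comb s.2 z') a * w a) := by
      rw [ENNReal.ofReal_sum_of_nonneg fun a _ => mul_nonneg (fairPolicy_nonneg _ _ _ _) (hw0 a)]
      exact Finset.sum_congr rfl fun a _ =>
        (ENNReal.ofReal_mul (fairPolicy_nonneg _ _ _ _)).symm
    have hSe : ∀ y, S y = ENNReal.ofReal (∑ a, e a y) := fun y => by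
      rw [ENNReal.ofReal_sum_of_nonneg fun a _ => he0 a y]
    have n1 : 0 ≤ ∑ a, fairPolicy f x (s.1 + comb s.2 z') a * w a :=
      Finset.sum_nonneg fun a _ => mul_nonneg (fairPolicy_nonneg _ _ _ _) (hw0 a)
    have n2 : ∀ y, 0 ≤ ∑ a, e a y := fun y => Finset.sum_nonneg fun a _ => he0 a y
    rw [hsum, hSe, hSe, hA, ← ENNReal.ofReal_mul hc0, ← ENNReal.ofReal_mul hc0,
      ← ENNReal.ofReal_add n1 (by positivity),
      ← ENNReal.ofReal_add (by positivity) (mul_nonneg hc0 (n2 _)),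
      ← ENNReal.ofReal_add (add_nonneg (by positivity) (mul_nonneg hc0 (n2 _)))
        (mul_nonneg hc0 (n2 _))]
    congr 1
    rw [Finset.sum_add_distrib]
    ring
  have hcS : ∫⁻ z, ENNReal.ofReal c * S z ∂stdGaussian (Param d) ≤ ENNReal.ofReal (c * (K * 2)) := by
    rw [lintegral_const_mul _ hSm, ENNReal.ofReal_mul hc0]
    gcongr
    refine hSint.trans (le_of_eq ?_)
    rw [ENNReal.ofReal_mul hK.le]
    simp
  calc _ = ∫⁻ z, ∫⁻ z', ENNReal.ofReal (∑ a, |fairPolicy f x (s.1 + comb s.2 z) a -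
        fairPolicy f x (s.1 + comb s.2 z') a|) ∂stdGaussian (Param d) ∂stdGaussian (Param d) := by
        have h : Measurable fun μ => ∫⁻ θ, ENNReal.ofReal
            (∑ a, |fairPolicy f x μ a - fairPolicy f x θ a|) ∂gaussKernel d s :=
          hpair.lintegral_kernel_prod_right' (κ := Kernel.const _ (gaussKernel d s))
        rw [lintegral_gaussKernel _ h]
        refine lintegral_congr fun z => ?_
        have hz : Measurable fun p : Param d => (s.1 + comb s.2 z, p) := measurable_prodMk_left
        have h' := hpair.comp hz
        simp only [Function.comp_def] at h'
        rw [lintegral_gaussKernel s h']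
    _ ≤ ∫⁻ z, ((∫⁻ z', Ψ (s.1 + comb s.2 z') ∂stdGaussian (Param d)) + A +
          ENNReal.ofReal (c * (K * 2))) + ENNReal.ofReal c * S z ∂stdGaussian (Param d) := by
        refine lintegral_mono fun z => ?_
        refine (lintegral_mono fun z' => hpt z z').trans ?_
        rw [lintegral_add_right _ measurable_const, lintegral_add_right _ (hSm.const_mul _),
          lintegral_add_right _ measurable_const]
        simp only [lintegral_const, measure_univ, mul_one]
        gcongr
    _ ≤ (∫⁻ z', Ψ (s.1 + comb s.2 z') ∂stdGaussian (Param d)) + A +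
          ENNReal.ofReal (c * (K * 2)) + ENNReal.ofReal (c * (K * 2)) := by
        rw [lintegral_add_right _ (hSm.const_mul _)]
        simp only [lintegral_const, measure_univ, mul_one]
        gcongr
    _ = _ := by
        rw [lintegral_gaussKernel s hΨ, add_assoc, add_assoc, hA,
          ← ENNReal.ofReal_add (by positivity) (by positivity),
          ← ENNReal.ofReal_add (by positivity) (by positivity)]
        congr 2
        rw [hc]
        field_simp
        ring

/-! ### The joint law of the parameter and the history -/

/-- The integrand of the next round for a function of the parameter and the extended history. -/
def extend {n : ℕ} (F : Param d × Hist d K (n + 1) → ℝ≥0∞) (h : Hist d K n)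
    (q : Param d × Round d K) : ℝ≥0∞ := F (q.1, append n (h, q.2))

theorem measurable_extend {n : ℕ} {F : Param d × Hist d K (n + 1) → ℝ≥0∞} (hF : Measurable F)
    (h : Hist d K n) : Measurable (extend F h) :=
  hF.comp (measurable_fst.prodMk
    ((measurable_append n).comp (measurable_const.prodMk measurable_snd)))

theorem measurable_playIntegral_pair (f : MeritFunction) {n : ℕ}
    {F : Param d × Hist d K (n + 1) → ℝ≥0∞}
    (hF : Measurable F) (h : Hist d K n) (x : Contexts d K) :
    Measurable fun p : Param d × Param d => playIntegral f (extend F h) p.1 x p.2 := by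
  have hp : Measurable fun p : Param d × Param d => (p.1, x, p.2) :=
    measurable_fst.prodMk (measurable_const.prodMk measurable_snd)
  have := (measurable_playIntegral f (measurable_extend hF h)).comp hp
  simpa only [Function.comp_def] using this

theorem lintegral_playIntegral_eq (f : MeritFunction) {n : ℕ}
    {F : Param d × Hist d K (n + 1) → ℝ≥0∞}
    (hF : Measurable F) (h : Hist d K n) {x : Contexts d K} (hx : ∀ a, ‖x a‖ ≤ 1) :
    ∫⁻ μ, ∫⁻ θ, playIntegral f (extend F h) μ x θ ∂gaussPosterior n h ∂gaussPosterior n h =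
      ∫⁻ θ, ∑ a, ENNReal.ofReal (fairPolicy f x θ a) *
        ∫⁻ w, ∫⁻ μ, F (μ, append n (h, x, fairPolicy f x θ, a,
            inner ℝ (posteriorState n h).1 (x a) +
              scale (coadj (posteriorState n h).2 (x a)) * w))
          ∂gaussPosterior (n + 1) (append n (h, x, fairPolicy f x θ, a,
            inner ℝ (posteriorState n h).1 (x a) +
              scale (coadj (posteriorState n h).2 (x a)) * w))
          ∂gaussianReal 0 1 ∂gaussPosterior n h := by
  -- With the sampled parameter fixed first, the policy does not depend on the true parameter, and
  -- conjugacy applies arm by arm.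
  rw [lintegral_lintegral_swap (measurable_playIntegral_pair f hF h x).aemeasurable]
  refine lintegral_congr fun θ => ?_
  have hin : ∀ a, Measurable fun q : Param d × ℝ =>
      extend F h (q.1, x, fairPolicy f x θ, a, q.2) := fun a =>
    (measurable_extend hF h).comp (measurable_fst.prodMk (measurable_const.prodMk
      (measurable_const.prodMk (measurable_const.prodMk measurable_snd))))
  have hin' : ∀ a, Measurable fun μ : Param d =>
      ∫⁻ r, extend F h (μ, x, fairPolicy f x θ, a, r) ∂gaussianReal (inner ℝ μ (x a)) 1 := by
    intro a
    have hi : Measurable fun μ : Param d => (inner ℝ μ (x a) : ℝ) := by fun_prop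
    exact (hin a).lintegral_kernel_prod_right' (κ := rewardKernel.comap _ hi)
  unfold playIntegral
  rw [lintegral_finsetSum _ fun a _ => (hin' a).const_mul _]
  refine Finset.sum_congr rfl fun a _ => ?_
  rw [lintegral_const_mul _ (hin' a)]
  congr 1
  refine (lintegral_conjugacy (posteriorState n h) (x a) (hin a)).trans ?_
  refine lintegral_congr fun w => ?_
  rw [gaussPosterior, Kernel.comap_apply, posteriorState_append]
  simp only [played, clip_of_norm_le (hx a)]
  rfl

section Joint

variable [NeZero K] (f : MeritFunction) (ctx : ∀ n, Kernel (Hist d K n) (Contexts d K))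
  [∀ n, IsMarkovKernel (ctx n)]

/-- The joint law of the true parameter and the history of the first `n` rounds, under the standard
Gaussian prior. -/
def joint (n : ℕ) : Measure (Param d × Hist d K n) :=
  stdGaussian (Param d) ⊗ₘ histKernel f (stdGaussian (Param d)) ctx n

/-- The law of the history of the first `n` rounds, under the standard Gaussian prior. -/
def marginal (n : ℕ) : Measure (Hist d K n) :=
  histKernel f (stdGaussian (Param d)) ctx n ∘ₘ stdGaussian (Param d)

instance (n : ℕ) : IsProbabilityMeasure (joint f ctx n) := by unfold joint; infer_instance

instance (n : ℕ) : IsProbabilityMeasure (marginal f ctx n) := by unfold marginal; infer_instance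

theorem lintegral_marginal (n : ℕ) {g : Hist d K n → ℝ≥0∞} (hg : Measurable g) :
    ∫⁻ h, g h ∂marginal f ctx n = ∫⁻ p, g p.2 ∂joint f ctx n := by
  rw [marginal, ← Measure.snd_compProd, Measure.snd, lintegral_map hg measurable_snd, joint]

theorem lintegral_joint_succ (n : ℕ) {F : Param d × Hist d K (n + 1) → ℝ≥0∞}
    (hF : Measurable F) :
    ∫⁻ p, F p ∂joint f ctx (n + 1) =
      ∫⁻ p, ∫⁻ r, F (p.1, append n (p.2, r)) ∂roundKernel f (ctx n)
        (posterior (histKernel f (stdGaussian (Param d)) ctx n) (stdGaussian (Param d))) p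
        ∂joint f ctx n := by
  have happ : Measurable fun q : (Param d × Hist d K n) × Round d K =>
      (q.1.1, append n (q.1.2, q.2)) :=
    measurable_fst.fst.prodMk
      ((measurable_append n).comp (measurable_fst.snd.prodMk measurable_snd))
  have h1 : Measurable fun q : (Param d × Hist d K n) × Round d K =>
      F (q.1.1, append n (q.1.2, q.2)) := hF.comp happ
  have h2 := h1.lintegral_kernel_prod_right' (κ := roundKernel f (ctx n)
    (posterior (histKernel f (stdGaussian (Param d)) ctx n) (stdGaussian (Param d))))
  rw [joint, joint, Measure.lintegral_compProd hF, Measure.lintegral_compProd h2]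
  refine lintegral_congr fun μ => ?_
  have hFμ : Measurable fun h => F (μ, h) := hF.comp measurable_prodMk_left
  have hp : Measurable fun q : Hist d K n × Round d K => ((μ, q.1), q.2) :=
    (measurable_const.prodMk measurable_fst).prodMk measurable_snd
  have h3 := h1.comp hp
  simp only [Function.comp_def] at h3
  rw [histKernel_succ, Kernel.lintegral_map _ (measurable_append n) _ hFμ]
  exact Kernel.lintegral_compProd _ _ _ h3

/-- The Gaussian posterior is the conditional law of the parameter given the first `n` rounds. -/
def IsGaussPosterior (n : ℕ) : Prop :=
  ∀ F : Param d × Hist d K n → ℝ≥0∞, Measurable F →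
    ∫⁻ p, F p ∂joint f ctx n = ∫⁻ h, ∫⁻ μ, F (μ, h) ∂gaussPosterior n h ∂marginal f ctx n

variable {f ctx}

/-- Uniqueness of disintegrations. Equality almost everywhere suffices, since the posterior is only
ever integrated against the law of the history. -/
theorem IsGaussPosterior.posterior_ae_eq {n : ℕ} (H : IsGaussPosterior f ctx n) :
    ∀ᵐ h ∂marginal f ctx n,
      posterior (histKernel f (stdGaussian (Param d)) ctx n) (stdGaussian (Param d)) h =
        gaussPosterior n h := by
  have : gaussPosterior n =ᵐ[marginal f ctx n]
      posterior (histKernel f (stdGaussian (Param d)) ctx n) (stdGaussian (Param d)) := by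
    refine ae_eq_posterior_of_compProd_eq (Measure.ext_of_lintegral _ fun F hF => ?_)
    rw [Measure.lintegral_compProd hF, lintegral_map hF measurable_swap]
    exact (H _ (hF.comp measurable_swap)).symm
  filter_upwards [this] with h hh using hh.symm

/-- This is the step of posterior sampling: given the history, the contexts and two independent
draws from the Gaussian posterior, one of them the true parameter, determine the law of the next
round. The contexts may be drawn before the true parameter because their law depends on the history
only. -/
theorem IsGaussPosterior.lintegral_succ {n : ℕ} (H : IsGaussPosterior f ctx n)
    {F : Param d × Hist d K (n + 1) → ℝ≥0∞} (hF : Measurable F) :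
    ∫⁻ p, F p ∂joint f ctx (n + 1) =
      ∫⁻ h, ∫⁻ x, ∫⁻ μ, ∫⁻ θ, playIntegral f (extend F h) μ x θ
        ∂gaussPosterior n h ∂gaussPosterior n h ∂ctx n h ∂marginal f ctx n := by
  have happ : Measurable fun q : (Param d × Hist d K n) × Round d K =>
      (q.1.1, append n (q.1.2, q.2)) :=
    measurable_fst.fst.prodMk
      ((measurable_append n).comp (measurable_fst.snd.prodMk measurable_snd))
  have h1 : Measurable fun q : (Param d × Hist d K n) × Round d K =>
      F (q.1.1, append n (q.1.2, q.2)) := hF.comp happ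
  have h2 := h1.lintegral_kernel_prod_right' (κ := roundKernel f (ctx n)
    (posterior (histKernel f (stdGaussian (Param d)) ctx n) (stdGaussian (Param d))))
  rw [lintegral_joint_succ f ctx n hF, H _ h2]
  refine lintegral_congr_ae ?_
  filter_upwards [H.posterior_ae_eq] with h hh
  have h3 : ∀ μ, ∫⁻ r, F (μ, append n (h, r)) ∂roundKernel f (ctx n)
      (posterior (histKernel f (stdGaussian (Param d)) ctx n) (stdGaussian (Param d))) (μ, h) =
      ∫⁻ x, ∫⁻ θ, playIntegral f (extend F h) μ x θ ∂gaussPosterior n h ∂ctx n h := by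
    intro μ
    rw [← hh]
    exact lintegral_roundKernel f (ctx n) _ μ h (measurable_extend hF h)
  simp only [h3]
  have h4 : Measurable fun q : (Param d × Contexts d K) × Param d =>
      playIntegral f (extend F h) q.1.1 q.1.2 q.2 := by
    have hp : Measurable fun q : (Param d × Contexts d K) × Param d => (q.1.1, q.1.2, q.2) :=
      measurable_fst.fst.prodMk (measurable_fst.snd.prodMk measurable_snd)
    have := (measurable_playIntegral f (measurable_extend hF h)).comp hp
    simpa only [Function.comp_def] using this
  have h5 := h4.lintegral_kernel_prod_right' (κ := Kernel.const _ (gaussPosterior n h))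
  exact lintegral_lintegral_swap h5.aemeasurable

variable (f ctx) in
theorem isGaussPosterior (hctx : ∀ n h, ∀ᵐ x ∂(ctx n h), ∀ a, ‖x a‖ ≤ 1) :
    ∀ n, IsGaussPosterior f ctx n
  | 0 => by
    intro F hF
    have h1 : Measurable fun h : Hist d K 0 => ∫⁻ μ, F (μ, h) ∂gaussPosterior 0 h :=
      (hF.comp measurable_swap).lintegral_kernel_prod_right' (κ := gaussPosterior 0)
    have h1' : Measurable fun p : Param d × Hist d K 0 =>
        ∫⁻ μ, F (μ, p.2) ∂gaussPosterior 0 p.2 := 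
      h1.comp measurable_snd
    have hcomb : ∀ z : Param d, comb (fun i => EuclideanSpace.single i (1 : ℝ)) z = z := by
      intro z
      ext j
      simp [comb, Pi.single_apply]
    have hg : ∀ h : Hist d K 0, gaussPosterior 0 h = stdGaussian (Param d) := by
      intro h
      refine Measure.ext_of_lintegral _ fun G hG => ?_
      rw [gaussPosterior, Kernel.lintegral_comap, lintegral_gaussKernel _ hG]
      simp [posteriorState, hcomb]
    rw [lintegral_marginal f ctx 0 h1, joint, Measure.lintegral_compProd hF,
      Measure.lintegral_compProd h1']
    simp only [hg, histKernel_zero, Kernel.const_apply]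
    have h2 : ∀ h : Hist d K 0, h = Fin.elim0 := fun h => Subsingleton.elim _ _
    simp only [h2, lintegral_const, measure_univ, mul_one]
  | n + 1 => by
    intro F hF
    have H := isGaussPosterior hctx n
    have hg : Measurable fun h : Hist d K (n + 1) => ∫⁻ μ, F (μ, h) ∂gaussPosterior (n + 1) h :=
      (hF.comp measurable_swap).lintegral_kernel_prod_right' (κ := gaussPosterior (n + 1))
    have hF' : Measurable fun p : Param d × Hist d K (n + 1) =>
        ∫⁻ μ, F (μ, p.2) ∂gaussPosterior (n + 1) p.2 := 
      hg.comp measurable_snd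
    rw [lintegral_marginal f ctx (n + 1) hg, H.lintegral_succ hF, H.lintegral_succ hF']
    refine lintegral_congr fun h => lintegral_congr_ae ?_
    filter_upwards [hctx n h] with x hx
    -- In this form both sides integrate against the updated Gaussian; the second integrand is
    -- already averaged over it, so averaging again changes nothing.
    rw [lintegral_playIntegral_eq f hF h hx, lintegral_playIntegral_eq f hF' h hx]
    simp only [lintegral_const, measure_univ, mul_one]

end Joint

/-! ### The Bayesian regret bound -/

theorem fairnessRegret_append (f : MeritFunction) (μ : Param d) {n : ℕ} (h : Hist d K n)
    (r : Round d K) :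
    fairnessRegret f μ (append n (h, r)) =
      fairnessRegret f μ h + ∑ a, |fairPolicy f r.1 μ a - r.2.1 a| := by
  simp [fairnessRegret, append, Fin.sum_univ_castSucc]

theorem fairnessRegret_nonneg (f : MeritFunction) (μ : Param d) {n : ℕ} (h : Hist d K n) :
    0 ≤ fairnessRegret f μ h :=
  Finset.sum_nonneg fun _ _ => Finset.sum_nonneg fun _ _ => abs_nonneg _

theorem measurable_fairnessRegret (f : MeritFunction) (n : ℕ) :
    Measurable fun p : Param d × Hist d K n => fairnessRegret f p.1 p.2 := by
  unfold fairnessRegret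
  refine Finset.measurable_sum _ fun t _ => Finset.measurable_sum _ fun a _ => ?_
  have ht : Measurable fun p : Param d × Hist d K n => p.2 t :=
    (measurable_pi_apply t).comp measurable_snd
  have h1 : Measurable fun p : Param d × Hist d K n => fairPolicy f (p.2 t).1 p.1 a := by
    have := (measurable_fairPolicy f a).comp (ht.fst.prodMk measurable_fst)
    simpa only [Function.comp_def] using this
  have h2 : Measurable fun p : Param d × Hist d K n => (p.2 t).2.1 a := by
    have := (measurable_pi_apply a).comp ht.snd.fst
    simpa only [Function.comp_def] using this
  simpa only [Real.norm_eq_abs, Pi.sub_apply] using (h1.sub h2).norm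

theorem sum_ofReal_fairPolicy [NeZero K] (f : MeritFunction) (x : Contexts d K) (θ : Param d) :
    ∑ a, ENNReal.ofReal (fairPolicy f x θ a) = 1 := by
  rw [← ENNReal.ofReal_sum_of_nonneg fun a _ => fairPolicy_nonneg f _ _ a, sum_fairPolicy,
    ENNReal.ofReal_one]

section Joint

variable [NeZero K] {f : MeritFunction} {ctx : ∀ n, Kernel (Hist d K n) (Contexts d K)}
  [∀ n, IsMarkovKernel (ctx n)]

/-- The regret of a round involves neither the arm nor the reward, so both integrate out. -/
theorem playIntegral_regret {n : ℕ} (h : Hist d K n) (μ : Param d) (x : Contexts d K)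
    (θ : Param d) :
    playIntegral f (extend (fun p => ENNReal.ofReal (fairnessRegret f p.1 p.2)) h) μ x θ =
      ENNReal.ofReal (fairnessRegret f μ h) +
        ENNReal.ofReal (∑ a, |fairPolicy f x μ a - fairPolicy f x θ a|) := by
  simp only [playIntegral, extend, fairnessRegret_append, lintegral_const, measure_univ, mul_one]
  rw [← Finset.sum_mul, sum_ofReal_fairPolicy, one_mul,
    ENNReal.ofReal_add (fairnessRegret_nonneg _ _ _) (Finset.sum_nonneg fun _ _ => abs_nonneg _)]

/-- The Gaussian covariance update does not involve the reward, so the growth of the potential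
depends only on the played direction. -/
theorem playIntegral_logDet {n : ℕ} {c : ℝ} (hc : 0 ≤ c) (h : Hist d K n) (μ : Param d)
    {x : Contexts d K} (hx : ∀ a, ‖x a‖ ≤ 1) (θ : Param d) :
    playIntegral f (extend (fun p => ENNReal.ofReal (c * logDet (n + 1) p.2)) h) μ x θ =
      ENNReal.ofReal (c * logDet n h) +
        ∑ a, ENNReal.ofReal (fairPolicy f x θ a) *
          ENNReal.ofReal (c * Real.log (1 + ‖coadj (posteriorState n h).2 (x a)‖ ^ 2)) := by
  have hlog : ∀ a, 0 ≤ Real.log (1 + ‖coadj (posteriorState n h).2 (x a)‖ ^ 2) := fun a =>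
    Real.log_nonneg (le_add_of_nonneg_right (sq_nonneg _))
  simp only [playIntegral, extend, logDet_append, lintegral_const, measure_univ, mul_one, played,
    clip_of_norm_le (hx _), mul_add]
  simp only [ENNReal.ofReal_add (mul_nonneg hc (logDet_nonneg n h)) (mul_nonneg hc (hlog _)),
    mul_add, Finset.sum_add_distrib]
  rw [← Finset.sum_mul, sum_ofReal_fairPolicy, one_mul]

theorem lintegral_fairnessRegret_le {L γ l : ℝ} (hL : 0 < L) (hγ : 0 < γ) (hl : 0 < l)
    (hf : ∀ x, γ ≤ f.merit x) (hLip : ∀ x y, |f.merit x - f.merit y| ≤ L * |x - y|)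
    (hctx : ∀ n h, ∀ᵐ x ∂(ctx n h), ∀ a, ‖x a‖ ≤ 1) (n : ℕ) :
    ∫⁻ p, ENNReal.ofReal (fairnessRegret f p.1 p.2) ∂joint f ctx n ≤
      ∫⁻ p, ENNReal.ofReal (4 * L * l / γ * logDet n p.2) ∂joint f ctx n +
        n * ENNReal.ofReal (8 * L / (γ * l) * (Real.log K + 2)) := by
  induction n with
  | zero => simp [fairnessRegret]
  | succ n ih =>
    have H := isGaussPosterior f ctx hctx n
    set c := 4 * L * l / γ with hc
    have hc0 : 0 ≤ c := by positivity
    set A := ENNReal.ofReal (8 * L / (γ * l) * (Real.log K + 2)) with hA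
    have hR : ∀ m, Measurable fun p : Param d × Hist d K m =>
        ENNReal.ofReal (fairnessRegret f p.1 p.2) := fun m =>
      (measurable_fairnessRegret f m).ennreal_ofReal
    have hD' : ∀ m, Measurable fun h : Hist d K m => ENNReal.ofReal (c * logDet m h) := fun m =>
      ((measurable_logDet m).const_mul c).ennreal_ofReal
    have hD : ∀ m, Measurable fun p : Param d × Hist d K m =>
        ENNReal.ofReal (c * logDet m p.2) := fun m => (hD' m).comp measurable_snd
    have hRμ : ∀ h : Hist d K n, Measurable fun μ => ENNReal.ofReal (fairnessRegret f μ h) := by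
      intro h
      have hp : Measurable fun μ : Param d => (μ, h) := measurable_prodMk_right
      have := (hR n).comp hp
      simpa only [Function.comp_def] using this
    have hRint : Measurable fun h : Hist d K n =>
        ∫⁻ μ, ENNReal.ofReal (fairnessRegret f μ h) ∂gaussPosterior n h := by
      have := (hR n).comp (measurable_swap (α := Hist d K n))
      exact this.lintegral_kernel_prod_right' (κ := gaussPosterior n)
    -- The expected growth of the scaled potential given the history. It bounds the new regret up to
    -- `A` (`h1`) and is exactly the increment of the potential (`h2`), so the induction closes.
    set P : Hist d K n → ℝ≥0∞ := fun h => ∫⁻ x, ∫⁻ θ, ∑ a, ENNReal.ofReal (fairPolicy f x θ a) *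
      ENNReal.ofReal (c * Real.log (1 + ‖coadj (posteriorState n h).2 (x a)‖ ^ 2))
        ∂gaussPosterior n h ∂ctx n h with hP
    have h1 : ∫⁻ p, ENNReal.ofReal (fairnessRegret f p.1 p.2) ∂joint f ctx (n + 1) ≤
        ∫⁻ p, ENNReal.ofReal (fairnessRegret f p.1 p.2) ∂joint f ctx n +
          (∫⁻ h, P h ∂marginal f ctx n + A) := by
      rw [H.lintegral_succ (hR (n + 1)), H _ (hR n)]
      have : ∀ h, ∫⁻ x, ∫⁻ μ, ∫⁻ θ, playIntegral f
          (extend (fun p => ENNReal.ofReal (fairnessRegret f p.1 p.2)) h) μ x θ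
          ∂gaussPosterior n h ∂gaussPosterior n h ∂ctx n h ≤
          ∫⁻ μ, ENNReal.ofReal (fairnessRegret f μ h) ∂gaussPosterior n h + (P h + A) := by
        intro h
        have hx : ∀ᵐ x ∂ctx n h, ∫⁻ μ, ∫⁻ θ, playIntegral f
            (extend (fun p => ENNReal.ofReal (fairnessRegret f p.1 p.2)) h) μ x θ
            ∂gaussPosterior n h ∂gaussPosterior n h ≤
            ∫⁻ μ, ENNReal.ofReal (fairnessRegret f μ h) ∂gaussPosterior n h +
              (∫⁻ θ, ∑ a, ENNReal.ofReal (fairPolicy f x θ a) *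
                ENNReal.ofReal (c * Real.log (1 + ‖coadj (posteriorState n h).2 (x a)‖ ^ 2))
                ∂gaussPosterior n h + A) := by
          filter_upwards [hctx n h] with x hx
          simp only [playIntegral_regret]
          have e1 : ∀ μ, ∫⁻ θ, (ENNReal.ofReal (fairnessRegret f μ h) + ENNReal.ofReal
              (∑ a, |fairPolicy f x μ a - fairPolicy f x θ a|)) ∂gaussPosterior n h =
              ENNReal.ofReal (fairnessRegret f μ h) + ∫⁻ θ, ENNReal.ofReal
              (∑ a, |fairPolicy f x μ a - fairPolicy f x θ a|) ∂gaussPosterior n h := by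
            intro μ
            rw [lintegral_add_left measurable_const]
            simp
          simp only [e1]
          rw [lintegral_add_left (hRμ h)]
          gcongr
          exact lintegral_sum_abs_fairPolicy_sub_le f hL hγ hl hf hLip (posteriorState n h)
            fun a => (norm_coadj_posteriorState_le n h (x a)).trans (hx a)
        refine (lintegral_mono_ae hx).trans (le_of_eq ?_)
        rw [lintegral_add_left measurable_const, lintegral_add_right _ measurable_const]
        simp [hP]
      refine (lintegral_mono this).trans (le_of_eq ?_)
      rw [lintegral_add_left hRint, lintegral_add_right _ measurable_const]
      simp
    have h2 : ∫⁻ p, ENNReal.ofReal (c * logDet (n + 1) p.2) ∂joint f ctx (n + 1) =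
        ∫⁻ p, ENNReal.ofReal (c * logDet n p.2) ∂joint f ctx n + ∫⁻ h, P h ∂marginal f ctx n := by
      rw [H.lintegral_succ (hD (n + 1)), ← lintegral_marginal f ctx n (hD' n),
        ← lintegral_add_left (hD' n)]
      refine lintegral_congr fun h => ?_
      have hx : ∀ᵐ x ∂ctx n h, ∫⁻ μ, ∫⁻ θ, playIntegral f
          (extend (fun p => ENNReal.ofReal (c * logDet (n + 1) p.2)) h) μ x θ
          ∂gaussPosterior n h ∂gaussPosterior n h =
          ENNReal.ofReal (c * logDet n h) + ∫⁻ θ, ∑ a, ENNReal.ofReal (fairPolicy f x θ a) *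
            ENNReal.ofReal (c * Real.log (1 + ‖coadj (posteriorState n h).2 (x a)‖ ^ 2))
            ∂gaussPosterior n h := by
        filter_upwards [hctx n h] with x hx
        simp only [playIntegral_logDet hc0 h _ hx]
        rw [lintegral_const, measure_univ, mul_one, lintegral_add_left measurable_const]
        simp
      rw [lintegral_congr_ae hx, lintegral_add_left measurable_const]
      simp [hP]
    rw [h2]
    refine h1.trans ((add_le_add_left ih _).trans (le_of_eq ?_))
    push_cast
    ring

theorem bayesFairnessRegret_le [NeZero d] {L γ l : ℝ} (hL : 0 < L) (hγ : 0 < γ) (hl : 0 < l)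
    (hf : ∀ x, γ ≤ f.merit x) (hLip : ∀ x y, |f.merit x - f.merit y| ≤ L * |x - y|)
    (hctx : ∀ n h, ∀ᵐ x ∂(ctx n h), ∀ a, ‖x a‖ ≤ 1) (T : ℕ) :
    bayesFairnessRegret f (stdGaussian (Param d)) ctx T ≤
      4 * L * l / γ * (d * Real.log (1 + T)) + T * (8 * L / (γ * l) * (Real.log K + 2)) := by
  have hK1 : (1 : ℝ) ≤ K := by exact_mod_cast NeZero.one_le
  have hlog : 0 ≤ Real.log K := Real.log_nonneg hK1
  have hlogT : 0 ≤ Real.log (1 + T) := 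
    Real.log_nonneg (le_add_of_nonneg_right (Nat.cast_nonneg T))
  have hle : ∫⁻ p, ENNReal.ofReal (fairnessRegret f p.1 p.2) ∂joint f ctx T ≤
      ENNReal.ofReal (4 * L * l / γ * (d * Real.log (1 + T)) +
        T * (8 * L / (γ * l) * (Real.log K + 2))) := by
    refine (lintegral_fairnessRegret_le hL hγ hl hf hLip hctx T).trans ?_
    rw [ENNReal.ofReal_add (by positivity) (by positivity),
      ENNReal.ofReal_mul (Nat.cast_nonneg T), ENNReal.ofReal_natCast]
    gcongr
    calc _ ≤ ∫⁻ p : Param d × Hist d K T, ENNReal.ofReal (4 * L * l / γ * (d * Real.log (1 + T)))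
          ∂joint f ctx T := by
          refine lintegral_mono fun p => ENNReal.ofReal_le_ofReal ?_
          gcongr
          exact logDet_le T p.2
      _ = _ := by simp
  have hm := measurable_fairnessRegret (d := d) (K := K) f T
  -- The bound just proved also supplies the integrability needed to pass from the iterated Bochner
  -- integral to the joint law.
  have hint : Integrable (fun p => fairnessRegret f p.1 p.2) (joint f ctx T) := by
    refine ⟨hm.aestronglyMeasurable, ?_⟩
    rw [hasFiniteIntegral_iff_ofReal (ae_of_all _ fun p => fairnessRegret_nonneg f _ _)]
    exact hle.trans_lt ENNReal.ofReal_lt_top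
  have heq : bayesFairnessRegret f (stdGaussian (Param d)) ctx T =
      ∫ p, fairnessRegret f p.1 p.2 ∂joint f ctx T :=
    (Measure.integral_compProd hint).symm
  rw [heq, integral_eq_lintegral_of_nonneg_ae (ae_of_all _ fun p => fairnessRegret_nonneg f _ _)
    hm.aestronglyMeasurable]
  exact ENNReal.toReal_le_of_le_ofReal (by positivity) hle

end Joint

end FairX

end

theorem theorem10 :
    ∃ (C : ℝ) (p : ℕ), 0 < C ∧
      ∀ (d K : ℕ) [NeZero d] [NeZero K] (f : FairX.MeritFunction) (L γ : ℝ),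
        0 < L → 0 < γ →
        (∀ x, γ ≤ f.merit x) →
        (∀ x y, |f.merit x - f.merit y| ≤ L * |x - y|) →
        ∀ (ctx : ∀ n, ProbabilityTheory.Kernel (FairX.Hist d K n) (FairX.Contexts d K))
          [∀ n, ProbabilityTheory.IsMarkovKernel (ctx n)],
          (∀ n h, ∀ᵐ x ∂(ctx n h), ∀ a, ‖x a‖ ≤ 1) →
          ∀ T : ℕ, 1 ≤ T →
            FairX.bayesFairnessRegret f (ProbabilityTheory.stdGaussian (FairX.Param d)) ctx T
              ≤ C * (L * Real.sqrt (d * T) / γ) * (1 + Real.log (K * T)) ^ p := by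
  -- The constant is `4 + 16`: the final bracket is `4 log (1 + T) + 8 log K + 16`, and `log (1 + T)
  -- ≤ 1 + log T`.
  refine ⟨20, 1, by norm_num, ?_⟩
  intro d K _ _ f L γ hL hγ hf hLip ctx _ hctx T hT
  have hd : (0 : ℝ) < d := by exact_mod_cast Nat.pos_of_ne_zero (NeZero.ne d)
  have hK1 : (1 : ℝ) ≤ K := by exact_mod_cast NeZero.one_le
  have hT1 : (1 : ℝ) ≤ T := by exact_mod_cast hT
  have hs : (0 : ℝ) < √(d * T) := Real.sqrt_pos.2 (by positivity)
  have hsq : √(d * T : ℝ) ^ 2 = d * T := Real.sq_sqrt (by positivity)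
  -- The weight `l = √(T/d)`, for which `l d` and `T / l` are both `√(dT)`.
  have hl : 0 < √(d * T : ℝ) / d := by positivity
  refine (FairX.bayesFairnessRegret_le hL hγ hl hf hLip hctx T).trans ?_
  have hlogK : 0 ≤ Real.log K := Real.log_nonneg hK1
  have hlogT : 0 ≤ Real.log T := Real.log_nonneg hT1
  have hlog2 : Real.log (1 + T) ≤ 1 + Real.log T := by
    calc Real.log (1 + T) ≤ Real.log (2 * T) := Real.log_le_log (by positivity) (by linarith)
      _ = Real.log 2 + Real.log T := Real.log_mul (by norm_num) (by positivity)
      _ ≤ 1 + Real.log T := by linarith [Real.log_two_lt_d9]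
  have e : 4 * L * (√(d * T) / d) / γ * (d * Real.log (1 + T)) +
      T * (8 * L / (γ * (√(d * T) / d)) * (Real.log K + 2)) =
      L * √(d * T) / γ * (4 * Real.log (1 + T) + 8 * Real.log K + 16) := by
    have h2 : (T : ℝ) * (8 * L / (γ * (√(d * T) / d)) * (Real.log K + 2)) =
        8 * L * (d * T) / (γ * √(d * T)) * (Real.log K + 2) := by
      field_simp
    obtain ⟨q, hq⟩ : ∃ q, q = √(d * T : ℝ) := ⟨_, rfl⟩
    rw [h2, ← hq]
    rw [← hq] at hsq hs
    rw [← hsq]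
    field_simp
    ring
  rw [e, pow_one, mul_comm (20 : ℝ), mul_assoc, Real.log_mul (by positivity) (by positivity)]
  gcongr
  linarith
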